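/- Let $G=(\mathcal N,E)$ be a directed graph on a countable vertex set with a distinguished source $n_0\in\mathcal N$ into which no edge points, such that every vertex has finitely many in-neighbours (for instance a finite or locally finite graph). Every edge $e=(u,v)\in E$ carries a Poisson clock of rate $\lambda_e=\lambda_{uv}>0$, all clocks being independent. Each vertex $v$ holds a timestamp $N_v(t)$: $N_v(0)=0$ for all $v$; $N_{n_0}(t)=t$ for all $t\ge 0$; and when the clock of $(u,v)$ rings at time $t$, $N_v(t)$ is replaced by $\max\{N_v(t),N_u(t)\}$ (on infinite graphs only timestamps that arrive through finitely many rings count). For a set $S$ of vertices, the age of information at time $t$ is $X_S(t)=\inf_{v\in S}(t-N_v(t))$. Let $E(S)$ be the set of edges $(u,v)\in E$ with $u\notin S$, $u\neq n_0$, $v\in S$; let $\lambda_0(S)=\sum_{v\in S,\,(n_0,v)\in E}\lambda_{n_0v}$; and for $e=(u,v)$ write $S\cup e=S\cup\{u,v\}$. Then for every $S\subset\mathcal N$ with $n_0\notin S$ that contains a vertex reachable from $n_0$ by a directed path, the law of $X_S(t)$ becomes time-invariant for large $t$: there is a probability measure on $\mathbb R$, the law of a random variable denoted $X_S$, with $\mathbb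 P(X_S(t)\le x)=\mathbb P(X_S\le x)$ for all $t\ge0$ and all $x<t$. For every integer $k\ge 0$ the moments $\mathbb E[X_S^k]$ and $\mathbb E[X_S(t)^k]$, $t\ge 0$, are finite, and $\mathbb E[X_S(t)^k]\to\mathbb E[X_S^k]$ as $t\to\infty$. If, moreover, $D=\lambda_0(S)+\sum_{e\in E(S)}\lambda_e<\infty$ (which always holds for finite $S$), then $D>0$ and for every integer $k\ge1$ $$\mathbb E[X_S^k]=\frac{k\,\mathbb E[X_S^{k-1}]+\sum_{e\in E(S)}\lambda_e\,\mathbb E[X_{S\cup e}^k]}{\lambda_0(S)+\sum_{e\in E(S)}\lambda_e}.$$ -/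

import Mathlib

open MeasureTheory ProbabilityTheory Filter Topology
open scoped NNReal ENNReal

/-- A (locally finite) directed gossip network on the vertex set `V`. The pair `(u, v)` is an edge
iff `0 < rate u v`, and `rate u v` is then the rate of the Poisson clock on that edge. No edge points
to the source. Local finiteness is only needed for in-neighbourhoods, so the source may update
infinitely many vertices. -/
structure GossipNetwork (V : Type*) where
  source : V
  rate : V → V → ℝ≥0
  rate_to_source : ∀ u, rate u source = 0
  finite_in : ∀ v, {u | 0 < rate u v}.Finite

/-- The number of rings in the time interval `(0, t]`. -/
noncomputable def ringCount (ring : Set ℝ) (t : ℝ≥0) : ℕ := (ring ∩ Set.Ioc 0 (t : ℝ)).ncard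

/-- The random set `ring` of ring times is that of a Poisson process of rate `r` on `(0, ∞)`:
it is locally finite, and its counting process has independent Poisson increments. -/
structure IsPoissonClock {Ω : Type*} [MeasurableSpace Ω] (P : Measure Ω) (r : ℝ≥0)
    (ring : Ω → Set ℝ) : Prop where
  pos : ∀ ω, ring ω ⊆ Set.Ioi 0
  locallyFinite : ∀ ω (t : ℝ), (ring ω ∩ Set.Iic t).Finite
  measurable_count : ∀ t, Measurable fun ω => ringCount (ring ω) t
  indep_increments : HasIndepIncrements (fun t ω => ringCount (ring ω) t) P
  law_increments : ∀ s t : ℝ≥0, s ≤ t →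
    HasLaw (fun ω => ringCount (ring ω) t - ringCount (ring ω) s) (poissonMeasure (r * (t - s))) P

namespace GossipNetwork

variable {V : Type*} (G : GossipNetwork V)

/-- The family `ring` consists of independent Poisson clocks, the clock of `(u, v)` having rate
`rate u v`. (Pairs that are not edges have rate `0`, so almost surely their clocks never ring.) -/
structure IsClockFamily {Ω : Type*} [MeasurableSpace Ω] (P : Measure Ω)
    (ring : V × V → Ω → Set ℝ) : Prop where
  isPoissonClock : ∀ e, IsPoissonClock P (G.rate e.1 e.2) (ring e)
  indep : iIndepFun (fun e ω t => ringCount (ring e ω) t) P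

/-- For one realization `ring` of the ring times, `G.HasStamp ring v t s` says that by time `t` the
vertex `v` has had a packet with timestamp `s`. All vertices start with a packet of timestamp `0`,
at every time `s` the source has a packet of timestamp `s`, and whenever the clock of `(u, v)` rings,
`u` passes its packet on to `v`. -/
inductive HasStamp (ring : V × V → Set ℝ) : V → ℝ → ℝ → Prop
  | init (v : V) : HasStamp ring v 0 0
  | source (s : ℝ) (hs : 0 ≤ s) : HasStamp ring G.source s s
  | keep {v : V} {t t' s : ℝ} (h : HasStamp ring v t s) (ht : t ≤ t') : HasStamp ring v t' s
  | recv {u v : V} {t s : ℝ} (h : HasStamp ring u t s) (ht : t ∈ ring (u, v)) :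
      HasStamp ring v t s

/-- The timestamp `N_v(t)` of the freshest packet that `v` has at time `t ≥ 0`. -/
noncomputable def stamp (ring : V × V → Set ℝ) (v : V) (t : ℝ) : ℝ :=
  sSup {s | G.HasStamp ring v t s}

/-- The age of information `X_S(t) = min_{v ∈ S} (t - N_v(t))` of the vertex set `S`. -/
noncomputable def age (ring : V × V → Set ℝ) (S : Set V) (t : ℝ) : ℝ :=
  ⨅ v : S, (t - G.stamp ring v t)

/-! Sanity checks: `stamp` obeys the rules of the gossip process. -/

variable {G}

theorem HasStamp.mem_Icc {ring : V × V → Set ℝ} {v : V} {t s : ℝ}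
    (h : G.HasStamp ring v t s) : 0 ≤ s ∧ s ≤ t := by
  induction h with
  | init v => simp
  | source s hs => exact ⟨hs, le_rfl⟩
  | keep _ ht ih => exact ⟨ih.1, ih.2.trans ht⟩
  | recv _ _ ih => exact ih

theorem bddAbove_hasStamp (ring : V × V → Set ℝ) (v : V) (t : ℝ) :
    BddAbove {s | G.HasStamp ring v t s} := ⟨t, fun _ h => h.mem_Icc.2⟩

theorem nonempty_hasStamp (ring : V × V → Set ℝ) (v : V) {t : ℝ} (ht : 0 ≤ t) :
    {s | G.HasStamp ring v t s}.Nonempty := ⟨0, (HasStamp.init v).keep ht⟩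

theorem stamp_source (ring : V × V → Set ℝ) {t : ℝ} (ht : 0 ≤ t) :
    G.stamp ring G.source t = t :=
  IsGreatest.csSup_eq ⟨HasStamp.source t ht, fun _ h => h.mem_Icc.2⟩

theorem stamp_zero (ring : V × V → Set ℝ) (v : V) : G.stamp ring v 0 = 0 :=
  IsGreatest.csSup_eq ⟨HasStamp.init v, fun _ h => h.mem_Icc.2⟩

theorem HasStamp.before {ring : V × V → Set ℝ} {v : V} {t s : ℝ}
    (h : G.HasStamp ring v t s) (hv : v ≠ G.source) {r : ℝ} (hr : 0 ≤ r) (hrt : r ≤ t) :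
    G.HasStamp ring v r s ∨ ∃ u, ∃ t' ∈ Set.Ioc r t, t' ∈ ring (u, v) ∧ G.HasStamp ring u t' s := by
  induction h with
  | init v => exact .inl ((HasStamp.init v).keep hr)
  | source s hs => exact absurd rfl hv
  | @keep v t t' s h ht ih =>
    rcases le_total r t with hle | hle
    · rcases ih hv hle with h1 | ⟨u, t1, h1, h2, h3⟩
      · exact .inl h1
      · exact .inr ⟨u, t1, ⟨h1.1, h1.2.trans ht⟩, h2, h3⟩
    · exact .inl (h.keep hle)
  | @recv u v t s h ht ih =>
    rcases hrt.eq_or_lt with rfl | hlt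
    · exact .inl (h.recv ht)
    · exact .inr ⟨u, t, ⟨hlt, le_rfl⟩, ht, h⟩

/-- The timestamp of `v` does not change while no clock into `v` rings. -/
theorem stamp_eq_of_silent {ring : V × V → Set ℝ} {v : V} (hv : v ≠ G.source) {r t : ℝ}
    (hr : 0 ≤ r) (hrt : r ≤ t) (hsil : ∀ u, ∀ t' ∈ Set.Ioc r t, t' ∉ ring (u, v)) :
    G.stamp ring v t = G.stamp ring v r := by
  unfold stamp
  congr 1
  ext s
  refine ⟨fun h => ?_, fun h => HasStamp.keep h hrt⟩
  rcases HasStamp.before h hv hr hrt with h1 | ⟨u, t1, h1, h2, -⟩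
  · exact h1
  · exact absurd h2 (hsil u t1 h1)

/-- When the clock of `(u, v)` rings at time `t`, and `r < t` is such that no other ring into `v`
happens in `(r, t]`, the timestamp of `v` is updated to `max (N_v(r)) (N_u(t))`. -/
theorem stamp_eq_of_ring {ring : V × V → Set ℝ} {u v : V} (hv : v ≠ G.source) {r t : ℝ}
    (hr : 0 ≤ r) (hrt : r ≤ t) (hring : t ∈ ring (u, v))
    (hsil : ∀ u', ∀ t' ∈ Set.Ioc r t, t' ∈ ring (u', v) → u' = u ∧ t' = t) :
    G.stamp ring v t = max (G.stamp ring v r) (G.stamp ring u t) := by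
  unfold stamp
  rw [← csSup_union (bddAbove_hasStamp ring v r) (nonempty_hasStamp ring v hr)
    (bddAbove_hasStamp ring u t) (nonempty_hasStamp ring u (hr.trans hrt))]
  congr 1
  ext s
  constructor
  · intro h
    rcases HasStamp.before h hv hr hrt with h1 | ⟨u1, t1, h1, h2, h3⟩
    · exact .inl h1
    · obtain ⟨rfl, rfl⟩ := hsil u1 t1 h1 h2
      exact .inr h3
  · rintro (h | h)
    · exact HasStamp.keep h hrt
    · exact HasStamp.recv h hring

variable (G)

/-- Some vertex of `S` can be reached from the source along edges of the network. -/
def Reaches (S : Set V) : Prop :=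
  ∃ v ∈ S, Relation.ReflTransGen (fun u w => 0 < G.rate u w) G.source v

/-- `E(S)`: the edges that start outside `S`, not at the source, and end in `S`. -/
def boundary (S : Set V) : Set (V × V) :=
  {e | 0 < G.rate e.1 e.2 ∧ e.1 ∉ S ∧ e.2 ∈ S ∧ e.1 ≠ G.source}

/-- `S` receives updates at a finite total rate. -/
def FiniteInRate (S : Set V) : Prop :=
  (Summable fun v : S => (G.rate G.source v : ℝ)) ∧
    Summable fun e : G.boundary S => (G.rate e.1.1 e.1.2 : ℝ)

/-- The total rate `λ₀(S) + ∑_{e ∈ E(S)} λ_e` of updates into `S`. -/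
noncomputable def inRate (S : Set V) : ℝ :=
  ∑' v : S, (G.rate G.source v : ℝ) + ∑' e : G.boundary S, (G.rate e.1.1 e.1.2 : ℝ)

/-- Every finite set of vertices receives updates at a finite total rate. -/
theorem finiteInRate_of_finite {S : Set V} (hS : S.Finite) : G.FiniteInRate S := by
  have : Finite S := hS
  have hb : (G.boundary S).Finite := by
    refine ((hS.biUnion fun v _ => (G.finite_in v).image fun u => (u, v))).subset ?_
    rintro ⟨u, v⟩ ⟨h1, -, h3, -⟩
    exact Set.mem_biUnion h3 ⟨u, h1, rfl⟩
  have : Finite (G.boundary S) := hb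
  exact ⟨Summable.of_finite, Summable.of_finite⟩

end GossipNetwork

/-! The age of `S` at time `t` is at least `x` exactly when no vertex of `S` holds a packet
generated after `t - x`. A packet that fresh has travelled only through rings in `(t - x, t]`, so
stationarity of the clocks makes the probability of this event a function `q_S(x)` that does not
depend on `t`, as long as `0 ≤ x ≤ t`. Thus the age at time `t` is distributed as `min X_S t`, where
`X_S` has tail `q_S`. A path from the source into `S` has been traversed by time `x` except with
exponentially small probability, so `X_S` is a finite random variable and all its moments are
finite.

Freshness is defined through paths of rings in continuous time, so stationarity, measurability and
independence of later rings are not immediate. They are proved for a discretization that sees only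
which clocks ring in which cell of a grid (`measure_gridFresh`). Almost surely no two clocks ring
together, hence fine grids decide freshness correctly and the properties pass to the limit
(`tendsto_measure_gridStale`, `measure_staleSet_add`, `measure_staleSet_inter_silentSet`).

For the recursion, look at the rings in `(x, x + d]`. If nothing enters `S`, staleness persists. If
the source updates `S`, staleness ends. If an edge `e` of `E(S)` rings, `S` can be stale only if `S
∪ e` was stale at `x`. Hence, with `D` the total rate into `S`, heuristically `q_S(x + d) = (1 - D
d) q_S(x) + d ∑ λ_e q_{S ∪ e}(x) + o(d)`. The rigorous form is a pair of bounds,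
`measure_staleSet_add_le` and `le_measure_staleSet_add`. No differentiability of `q_S` is needed:
both bounds are first integrated against `(k + 1) x ^ k`, which turns the left side into `E[((X_S -
d)⁺) ^ (k + 1)]`, with right derivative `-(k + 1) E[X_S ^ k]` at `d = 0`. Letting `d → 0`, with
dominated convergence for the possibly infinite sum over `E(S)`, squeezes out the moment identity.
-/

namespace GossipNetwork

variable {V : Type*} {G : GossipNetwork V}

/-! ### Fresh packets and ages for a fixed realization -/

variable (G) in
/-- Some vertex of `S` has, by time `t`, a packet that left the source after time `a`. -/
def HasFresh (ring : V × V → Set ℝ) (S : Set V) (a t : ℝ) : Prop :=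
  ∃ v ∈ S, ∃ s, a < s ∧ G.HasStamp ring v t s

theorem HasFresh.mono {ring : V × V → Set ℝ} {S S' : Set V} {a t t' : ℝ}
    (h : G.HasFresh ring S a t) (hS : S ⊆ S') (ht : t ≤ t') : G.HasFresh ring S' a t' := by
  obtain ⟨v, hv, s, hs, h⟩ := h
  exact ⟨v, hS hv, s, hs, h.keep ht⟩

/-- Follow the packet backwards in time from `v`. It cannot have originated at the source inside
`S`, and by silence it cannot have crossed into `S` after `r`, so its carrier at time `r` is already
in `S`. -/
theorem HasStamp.of_silent {ring : V × V → Set ℝ} {S : Set V} (hS : G.source ∉ S) {v : V}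
    {t s : ℝ} (h : G.HasStamp ring v t s) (hv : v ∈ S) {r : ℝ} (hr : 0 ≤ r) (hrt : r ≤ t)
    (hsil : ∀ u ∉ S, ∀ w ∈ S, ∀ t' ∈ Set.Ioc r t, t' ∉ ring (u, w)) :
    ∃ w ∈ S, G.HasStamp ring w r s := by
  induction h with
  | init v => exact ⟨v, hv, (HasStamp.init v).keep hr⟩
  | source s hs => exact absurd hv hS
  | @keep v t t' s h ht ih =>
    rcases le_total r t with hle | hle
    · exact ih hv hle fun u hu w hw t1 h1 => hsil u hu w hw t1 ⟨h1.1, h1.2.trans ht⟩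
    · exact ⟨v, hv, h.keep hle⟩
  | @recv u v t s h ht ih =>
    by_cases hu : u ∈ S
    · exact ih hu hrt hsil
    · rcases hrt.eq_or_lt with rfl | hlt
      · exact ⟨v, hv, h.recv ht⟩
      · exact absurd ht (hsil u hu v hv t ⟨hlt, le_rfl⟩)

/-- Fresh packets can enter `S` only through rings of clocks on edges into `S`. -/
theorem HasFresh.of_silent {ring : V × V → Set ℝ} {S : Set V} (hS : G.source ∉ S)
    {a t r : ℝ} (h : G.HasFresh ring S a t) (hr : 0 ≤ r) (hrt : r ≤ t)
    (hsil : ∀ u ∉ S, ∀ w ∈ S, ∀ t' ∈ Set.Ioc r t, t' ∉ ring (u, w)) :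
    G.HasFresh ring S a r := by
  obtain ⟨v, hv, s, hs, h⟩ := h
  obtain ⟨w, hw, h⟩ := h.of_silent hS hv hr hrt hsil
  exact ⟨w, hw, s, hs, h⟩

theorem HasFresh.recv {ring : V × V → Set ℝ} {u v : V} {a t b t' : ℝ}
    (h : G.HasFresh ring {u} a t) (ht : t ≤ t') (hr : t' ∈ ring (u, v)) (hb : t' ≤ b) :
    G.HasFresh ring {v} a b := by
  obtain ⟨_, rfl, s, hs, h⟩ := h
  exact ⟨v, rfl, s, hs, ((h.keep ht).recv hr).keep hb⟩

theorem hasFresh_of_source {ring : V × V → Set ℝ} {v : V} {a b t : ℝ} (ha : 0 ≤ a)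
    (hr : t ∈ ring (G.source, v)) (hat : a < t) (hb : t ≤ b) :
    G.HasFresh ring {v} a b :=
  ⟨v, rfl, t, hat, ((HasStamp.source t (ha.trans hat.le)).recv hr).keep hb⟩

theorem stamp_nonneg (ring : V × V → Set ℝ) (v : V) {t : ℝ} (ht : 0 ≤ t) :
    0 ≤ G.stamp ring v t :=
  le_csSup (bddAbove_hasStamp ring v t) ((HasStamp.init v).keep ht)

theorem stamp_le (ring : V × V → Set ℝ) (v : V) {t : ℝ} (ht : 0 ≤ t) :
    G.stamp ring v t ≤ t :=
  csSup_le (nonempty_hasStamp ring v ht) fun _ h => h.mem_Icc.2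

theorem age_nonneg (ring : V × V → Set ℝ) (S : Set V) {t : ℝ} (ht : 0 ≤ t) :
    0 ≤ G.age ring S t :=
  Real.iInf_nonneg fun v => sub_nonneg.2 (stamp_le ring v ht)

theorem bddBelow_age (ring : V × V → Set ℝ) (S : Set V) {t : ℝ} (ht : 0 ≤ t) :
    BddBelow (Set.range fun v : S => t - G.stamp ring v t) :=
  ⟨0, by rintro _ ⟨v, rfl⟩; exact sub_nonneg.2 (stamp_le ring v ht)⟩

theorem age_le (ring : V × V → Set ℝ) {S : Set V} (hS : S.Nonempty) {t : ℝ} (ht : 0 ≤ t) :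
    G.age ring S t ≤ t := by
  obtain ⟨v, hv⟩ := hS
  exact (ciInf_le (bddBelow_age ring S ht) ⟨v, hv⟩).trans
    (sub_le_self _ (stamp_nonneg ring v ht))

/-- The infimum over `S` and the suprema defining the stamps need not be attained; strict
inequalities pass through both. This replaces ages by freshness events throughout. -/
theorem age_lt_iff (ring : V × V → Set ℝ) {S : Set V} (hS : S.Nonempty) {t x : ℝ} (ht : 0 ≤ t) :
    G.age ring S t < x ↔ G.HasFresh ring S (t - x) t := by
  have : Nonempty S := hS.to_subtype
  rw [age, ciInf_lt_iff (bddBelow_age ring S ht)]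
  have h (v : V) : t - G.stamp ring v t < x ↔ ∃ s, t - x < s ∧ G.HasStamp ring v t s := by
    rw [sub_lt_comm, stamp, lt_csSup_iff (bddAbove_hasStamp ring v t) (nonempty_hasStamp ring v ht)]
    exact ⟨fun ⟨s, h1, h2⟩ => ⟨s, h2, h1⟩, fun ⟨s, h1, h2⟩ => ⟨s, h2, h1⟩⟩
  simp only [h, HasFresh, Subtype.exists, exists_prop]

/-! ### Discretization of freshness on a time grid -/

/-- The vertices that the source reaches along edges `e₁, e₂, …` such that `B eⱼ iⱼ` holds for some
`i₁ < i₂ < ⋯ < n`. -/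
def gridReach (src : V) (B : V × V → ℕ → Prop) : ℕ → V → Prop
  | 0, v => v = src
  | n + 1, v => gridReach src B n v ∨ ∃ u, gridReach src B n u ∧ B (u, v) n

theorem gridReach_congr {src : V} {B B' : V × V → ℕ → Prop} {n : ℕ}
    (h : ∀ e, ∀ i < n, B e i ↔ B' e i) (v : V) : gridReach src B n v ↔ gridReach src B' n v := by
  induction n generalizing v with
  | zero => rfl
  | succ n ih =>
    have ih := ih fun e i hi => h e i (hi.trans n.lt_succ_self)
    simp only [gridReach, ih, h _ n n.lt_succ_self]

theorem gridReach_mono {src : V} {B : V × V → ℕ → Prop} {v : V} :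
    Monotone fun n => gridReach src B n v :=
  monotone_nat_of_le_succ fun _ h => Or.inl h

theorem gridReach_source {src : V} {B : V × V → ℕ → Prop} (n : ℕ) : gridReach src B n src :=
  gridReach_mono (Nat.zero_le n) rfl

theorem measurableSet_gridReach [Countable V] {α : Type*} {m : MeasurableSpace α} {src : V}
    {B : α → V × V → ℕ → Prop} {n : ℕ} (h : ∀ e, ∀ i < n, MeasurableSet[m] {a | B a e i}) (v : V) :
    MeasurableSet[m] {a | gridReach src (B a) n v} := by
  induction n generalizing v with
  | zero => exact MeasurableSet.const _
  | succ n ih =>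
    have ih := ih fun e i hi => h e i (hi.trans n.lt_succ_self)
    have e : {a | gridReach src (B a) (n + 1) v} = {a | gridReach src (B a) n v} ∪
        ⋃ u, {a | gridReach src (B a) n u} ∩ {a | B a (u, v) n} := by
      ext a
      simp [gridReach]
    rw [e]
    exact (ih v).union (.iUnion fun u => (ih u).inter (h _ n n.lt_succ_self))

/-- The clock with rings `A` rings in the `i`-th of `n + 1` equal parts of `(a, a + x]`. -/
def RingsIn (A : Set ℝ) (a x : ℝ) (n i : ℕ) : Prop :=
  (A ∩ Set.Ioc (a + i * (x / (n + 1))) (a + (i + 1) * (x / (n + 1)))).Nonempty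

variable (G) in
/-- A discretization of `G.HasFresh ring S a (a + x)`. -/
def GridFresh (ring : V × V → Set ℝ) (S : Set V) (a x : ℝ) (n : ℕ) : Prop :=
  ∃ v ∈ S, gridReach G.source (fun e => RingsIn (ring e) a x n) (n + 1) v

/-- Rings in successive cells occur in the right order, so a grid path really carries a packet, and
that packet leaves the source at a ring after `a`. The grid therefore never reports false freshness.
-/
theorem HasFresh.of_gridReach {ring : V × V → Set ℝ} {v : V} {a x : ℝ} (ha : 0 ≤ a) (hx : 0 ≤ x)
    {n i : ℕ} (h : gridReach G.source (fun e => RingsIn (ring e) a x n) i v) :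
    v = G.source ∨ G.HasFresh ring {v} a (a + i * (x / (n + 1))) := by
  have hd : 0 ≤ x / ((n : ℝ) + 1) := by positivity
  induction i generalizing v with
  | zero => exact .inl h
  | succ i ih =>
    push_cast
    rcases h with h | ⟨u, h, t, ht, h1, h2⟩
    · exact (ih h).imp_right fun h => h.mono subset_rfl (by linarith)
    · right
      rcases ih h with rfl | h
      · exact hasFresh_of_source ha ht
          ((le_add_of_nonneg_right (mul_nonneg i.cast_nonneg hd)).trans_lt h1) h2
      · exact h.recv h1.le ht h2

theorem HasFresh.of_gridFresh {ring : V × V → Set ℝ} {S : Set V} (hS : G.source ∉ S) {a x : ℝ}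
    (ha : 0 ≤ a) (hx : 0 ≤ x) {n : ℕ} (h : G.GridFresh ring S a x n) :
    G.HasFresh ring S a (a + x) := by
  obtain ⟨v, hv, h⟩ := h
  rcases HasFresh.of_gridReach ha hx h with rfl | h
  · exact absurd hv hS
  · refine h.mono (by simpa using hv) (le_of_eq ?_)
    push_cast
    field_simp

/-- If `t` lies in `(a, a + x]`, it lies in the part with this number of `(a, a + x]`, counted from
`1`. -/
noncomputable def gridIndex (a x : ℝ) (n : ℕ) (t : ℝ) : ℕ := ⌈(t - a) / x * (n + 1)⌉₊

theorem gridIndex_mono {a x : ℝ} (hx : 0 < x) (n : ℕ) : Monotone (gridIndex a x n) := by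
  intro t t' h
  unfold gridIndex
  gcongr

theorem gridIndex_add {a x : ℝ} (hx : 0 < x) (n : ℕ) : gridIndex a x n (a + x) = n + 1 := by
  rw [gridIndex, add_sub_cancel_left, div_self hx.ne', one_mul]
  exact_mod_cast Nat.ceil_natCast (n + 1)

/-- The distance of the two times, measured in cells, tends to infinity, and once it is at least `1`
the ceilings differ. -/
theorem eventually_gridIndex_lt {a x t t' : ℝ} (hx : 0 < x) (h : t < t') (ht : a ≤ t) :
    ∀ᶠ n in atTop, gridIndex a x n t < gridIndex a x n t' := by
  have h1 : Tendsto (fun n : ℕ => (t' - t) / x * ((n : ℝ) + 1)) atTop atTop :=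
    Tendsto.const_mul_atTop (div_pos (sub_pos.2 h) hx)
      (tendsto_natCast_atTop_atTop.atTop_add tendsto_const_nhds)
  filter_upwards [h1.eventually_ge_atTop 1] with n hn
  have h2 : (t' - a) / x * ((n : ℝ) + 1) = (t - a) / x * (n + 1) + (t' - t) / x * (n + 1) := by ring
  unfold gridIndex
  rw [Nat.lt_ceil]
  refine (Nat.ceil_lt_add_one ?_).trans_le (by linarith)
  have := sub_nonneg.2 ht
  positivity

theorem exists_gridIndex_eq {a x t : ℝ} (hx : 0 < x) (ht : a < t) (n : ℕ) :
    ∃ i, gridIndex a x n t = i + 1 ∧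
      t ∈ Set.Ioc (a + i * (x / (n + 1))) (a + (i + 1) * (x / (n + 1))) := by
  have hpos : 0 < (t - a) / x * (n + 1) := by
    have := sub_pos.2 ht
    positivity
  obtain ⟨i, hi⟩ := Nat.exists_eq_succ_of_ne_zero (Nat.ceil_pos.2 hpos).ne'
  refine ⟨i, hi, ?_⟩
  rw [Nat.succ_eq_add_one, Nat.ceil_eq_iff (by simp)] at hi
  have hn : (0 : ℝ) < (n : ℝ) + 1 := by positivity
  have e : a + (t - a) / x * (n + 1) * (x / (n + 1)) = t := by field_simp; ring
  have hd : 0 < x / ((n : ℝ) + 1) := by positivity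
  constructor
  · rw [← e]
    have := mul_lt_mul_of_pos_right hi.1 hd
    push_cast at this
    linarith
  · have := mul_le_mul_of_nonneg_right hi.2 hd.le
    push_cast at this
    linarith

/-- The induction remembers a ring time `t'` at which the packet came to `v` from another vertex
`w`. The clock of the next hop is then a different one, so disjointness makes its ring strictly
later than `t'` and, on fine grids, in a later cell. Self-loops move nothing and are skipped; this
is what keeps `w ≠ v` available. -/
theorem HasStamp.eventually_gridReach {ring : V × V → Set ℝ}
    (hring : ∀ e e', e ≠ e' → Disjoint (ring e) (ring e')) {v : V} {a x t s : ℝ} (ha : 0 ≤ a)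
    (hx : 0 < x) (h : G.HasStamp ring v t s) (has : a < s) :
    v = G.source ∨ ∃ t', a < t' ∧ t' ≤ t ∧ (∃ w, w ≠ v ∧ t' ∈ ring (w, v)) ∧
      ∀ᶠ n in atTop,
        gridReach G.source (fun e => RingsIn (ring e) a x n) (gridIndex a x n t') v := by
  induction h with
  | init v => exact absurd has ha.not_gt
  | source s hs => exact .inl rfl
  | keep h ht ih =>
    exact (ih has).imp_right fun ⟨t', h1, h2, h3⟩ => ⟨t', h1, h2.trans ht, h3⟩
  | @recv u v t s h ht ih =>
    by_cases huv : u = v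
    · exact huv ▸ ih has
    right
    have hat : a < t := has.trans_le h.mem_Icc.2
    refine ⟨t, hat, le_rfl, ⟨u, huv, ht⟩, ?_⟩
    rcases ih has with rfl | ⟨t', h1, h2, ⟨w, hw, h3⟩, h4⟩
    · refine .of_forall fun n => ?_
      obtain ⟨i, hi, hti⟩ := exists_gridIndex_eq hx hat n
      rw [hi]
      exact .inr ⟨_, gridReach_source i, t, ht, hti⟩
    · have hlt : t' < t := by
        refine h2.lt_of_ne ?_
        rintro rfl
        refine Set.disjoint_left.1 (hring (w, u) (u, v) ?_) h3 ht
        simp [hw]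
      filter_upwards [h4, eventually_gridIndex_lt hx hlt h1.le] with n h5 h6
      obtain ⟨i, hi, hti⟩ := exists_gridIndex_eq hx hat n
      rw [hi] at h6 ⊢
      exact .inr ⟨u, gridReach_mono (Nat.lt_succ_iff.1 h6) h5, t, ht, hti⟩

/-- When no two clocks ring simultaneously, fine discretizations detect all fresh packets. -/
theorem HasFresh.eventually_gridFresh {ring : V × V → Set ℝ}
    (hring : ∀ e e', e ≠ e' → Disjoint (ring e) (ring e')) {S : Set V} {a x : ℝ} (ha : 0 ≤ a)
    (hx : 0 < x) (h : G.HasFresh ring S a (a + x)) :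
    ∀ᶠ n in atTop, G.GridFresh ring S a x n := by
  obtain ⟨v, hv, s, hs, h⟩ := h
  rcases h.eventually_gridReach hring ha hx hs with rfl | ⟨t', h1, h2, -, h4⟩
  · exact .of_forall fun n => ⟨_, hv, gridReach_source _⟩
  · filter_upwards [h4] with n hn
    refine ⟨v, hv, gridReach_mono ?_ hn⟩
    exact (gridIndex_mono hx n h2).trans_eq (gridIndex_add hx n)

end GossipNetwork

/-! ### Ring probabilities of a single Poisson clock -/

theorem IsPoissonClock.ringCount_sub_ne_zero_iff {Ω : Type*} [MeasurableSpace Ω] {P : Measure Ω}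
    {r : ℝ≥0} {ring : Ω → Set ℝ} (h : IsPoissonClock P r ring) {s t : ℝ≥0} (hst : s ≤ t) (ω : Ω) :
    ringCount (ring ω) t - ringCount (ring ω) s ≠ 0 ↔
      (ring ω ∩ Set.Ioc (s : ℝ) t).Nonempty := by
  have hfin (t : ℝ≥0) : (ring ω ∩ Set.Ioc 0 (t : ℝ)).Finite :=
    (h.locallyFinite ω t).subset (Set.inter_subset_inter_right _ Set.Ioc_subset_Iic_self)
  have hsub : ring ω ∩ Set.Ioc 0 (s : ℝ) ⊆ ring ω ∩ Set.Ioc 0 (t : ℝ) :=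
    Set.inter_subset_inter_right _ (Set.Ioc_subset_Ioc_right (by exact_mod_cast hst))
  have hdiff : (ring ω ∩ Set.Ioc 0 (t : ℝ)) \ (ring ω ∩ Set.Ioc 0 (s : ℝ)) =
      ring ω ∩ Set.Ioc (s : ℝ) t := by
    have : (0 : ℝ) ≤ s := s.2
    ext x
    simp only [Set.mem_sdiff, Set.mem_inter_iff, Set.mem_Ioc, not_and, not_le]
    constructor
    · rintro ⟨⟨h1, h2, h3⟩, h4⟩
      exact ⟨h1, h4 h1 h2, h3⟩
    · rintro ⟨h1, h2, h3⟩
      exact ⟨⟨h1, this.trans_lt h2, h3⟩, fun _ _ => h2⟩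
  rw [ringCount, ringCount, ← Set.ncard_sdiff hsub (hfin s), hdiff,
    ← Nat.pos_iff_ne_zero, Set.ncard_pos ((hfin t).subset (hdiff ▸ Set.sdiff_subset))]

theorem IsPoissonClock.measurableSet_rings {Ω : Type*} [MeasurableSpace Ω] {P : Measure Ω}
    {r : ℝ≥0} {ring : Ω → Set ℝ} (h : IsPoissonClock P r ring) {s t : ℝ≥0} (hst : s ≤ t) :
    MeasurableSet {ω | (ring ω ∩ Set.Ioc (s : ℝ) t).Nonempty} := by
  simp only [← h.ringCount_sub_ne_zero_iff hst]
  exact ((h.measurable_count t).sub (h.measurable_count s)) (measurableSet_singleton 0).compl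

theorem IsPoissonClock.measure_silent {Ω : Type*} [MeasurableSpace Ω] {P : Measure Ω}
    {r : ℝ≥0} {ring : Ω → Set ℝ} (h : IsPoissonClock P r ring) {s t : ℝ≥0} (hst : s ≤ t) :
    P {ω | ¬ (ring ω ∩ Set.Ioc (s : ℝ) t).Nonempty} =
      ENNReal.ofReal (Real.exp (-(r * (t - s : ℝ)))) := by
  simp only [← h.ringCount_sub_ne_zero_iff hst, not_not]
  have := (h.law_increments s t hst).measure_eq (p := fun n => n = 0) (measurableSet_singleton 0)
  rw [this, Set.ofPred_eq_eq_singleton, poissonMeasure_singleton]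
  simp [NNReal.coe_sub hst]

theorem IsPoissonClock.measure_rings_le {Ω : Type*} [MeasurableSpace Ω] {P : Measure Ω}
    [IsProbabilityMeasure P]
    {r : ℝ≥0} {ring : Ω → Set ℝ} (h : IsPoissonClock P r ring) {s t : ℝ≥0} (hst : s ≤ t) :
    P {ω | (ring ω ∩ Set.Ioc (s : ℝ) t).Nonempty} ≤ ENNReal.ofReal (r * (t - s : ℝ)) := by
  have := prob_compl_eq_one_sub (μ := P) (h.measurableSet_rings hst).compl
  rw [compl_compl] at this
  rw [this, show {ω | (ring ω ∩ Set.Ioc (s : ℝ) t).Nonempty}ᶜ =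
    {ω | ¬ (ring ω ∩ Set.Ioc (s : ℝ) t).Nonempty} from rfl, h.measure_silent hst,
    ← ENNReal.ofReal_one, ← ENNReal.ofReal_sub _ (Real.exp_pos _).le]
  apply ENNReal.ofReal_le_ofReal
  linarith [Real.add_one_le_exp (-(r * (t - s : ℝ)))]

/-! ### Joint law of the clocks: independent increments, no simultaneous rings, shift invariance -/

namespace GossipNetwork

variable {V : Type*} {G : GossipNetwork V} {Ω : Type*} [mΩ : MeasurableSpace Ω] {P : Measure Ω}
  {ring : V × V → Ω → Set ℝ}

/-- The number of rings of the clock `p.1` in the `p.2`-th interval of the partition `τ`. -/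
noncomputable def ringIncr (ring : V × V → Ω → Set ℝ) (τ : ℕ → ℝ≥0) (p : (V × V) × ℕ) (ω : Ω) : ℕ :=
  ringCount (ring p.1 ω) (τ (p.2 + 1)) - ringCount (ring p.1 ω) (τ p.2)

theorem IsClockFamily.measurable_ringIncr (h : G.IsClockFamily P ring) (τ : ℕ → ℝ≥0)
    (p : (V × V) × ℕ) : Measurable (ringIncr ring τ p) :=
  ((h.isPoissonClock p.1).measurable_count _).sub ((h.isPoissonClock p.1).measurable_count _)

/-- Independence between clocks and independence of the increments of each clock combine to joint
independence over all pairs of a clock and an interval. -/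
theorem IsClockFamily.iIndepFun_ringIncr (h : G.IsClockFamily P ring) {τ : ℕ → ℝ≥0}
    (hτ : Monotone τ) : iIndepFun (ringIncr ring τ) P := by
  refine iIndepFun_uncurry' (X := fun e i => ringIncr ring τ (e, i))
    (fun e i => h.measurable_ringIncr τ (e, i)) ?_ fun e => ?_
  · exact h.indep.comp (fun _ (c : ℝ≥0 → ℕ) i => c (τ (i + 1)) - c (τ i)) fun _ => by fun_prop
  · exact (h.isPoissonClock e).indep_increments.nat hτ

theorem IsClockFamily.hasLaw_ringIncr [Countable V] (h : G.IsClockFamily P ring) {τ : ℕ → ℝ≥0}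
    (hτ : Monotone τ) :
    HasLaw (fun ω p => ringIncr ring τ p ω) (Measure.infinitePi fun p : (V × V) × ℕ =>
      poissonMeasure (G.rate p.1.1 p.1.2 * (τ (p.2 + 1) - τ p.2))) P :=
  (h.iIndepFun_ringIncr hτ).hasLaw_infinitePi
    (fun p => (h.isPoissonClock p.1).law_increments _ _ (hτ p.2.le_succ))
    (measurable_pi_iff.2 fun p => h.measurable_ringIncr τ p).aemeasurable

theorem IsClockFamily.measure_rings_inter_le [IsProbabilityMeasure P] (h : G.IsClockFamily P ring)
    {e e' : V × V} (hne : e ≠ e') {s t : ℝ≥0} (hst : s ≤ t) :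
    P ({ω | (ring e ω ∩ Set.Ioc (s : ℝ) t).Nonempty} ∩
      {ω | (ring e' ω ∩ Set.Ioc (s : ℝ) t).Nonempty}) ≤
      ENNReal.ofReal (G.rate e.1 e.2 * (t - s : ℝ) * (G.rate e'.1 e'.2 * (t - s : ℝ))) := by
  have hind := (h.indep.comp (fun _ (c : ℝ≥0 → ℕ) => c t - c s) fun _ => by fun_prop).indepFun hne
  have := hind.measure_inter_preimage_eq_mul {0}ᶜ {0}ᶜ (measurableSet_singleton 0).compl
    (measurableSet_singleton 0).compl
  have hs (e) : (fun x => ringCount (ring e x) t - ringCount (ring e x) s) ⁻¹' {0}ᶜ =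
      {ω | (ring e ω ∩ Set.Ioc (s : ℝ) t).Nonempty} := by
    ext ω
    exact (h.isPoissonClock e).ringCount_sub_ne_zero_iff hst ω
  have h0 : (0 : ℝ) ≤ t - s := sub_nonneg.2 (by exact_mod_cast hst)
  simp only [Function.comp_def, hs] at this
  rw [this, ENNReal.ofReal_mul (by positivity)]
  exact mul_le_mul' ((h.isPoissonClock e).measure_rings_le hst)
    ((h.isPoissonClock e').measure_rings_le hst)

/-- The partition of `(a, ∞)` into intervals whose length is the `(n + 1)`-th part of `x`. -/
noncomputable def gridPoint (a x : ℝ≥0) (n i : ℕ) : ℝ≥0 := a + i * (x / (n + 1))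

theorem gridPoint_mono (a x : ℝ≥0) (n : ℕ) : Monotone (gridPoint a x n) := by
  intro i j h
  unfold gridPoint
  gcongr

theorem ringsIn_iff {A : Set ℝ} {a x : ℝ≥0} {n i : ℕ} :
    RingsIn A a x n i ↔
      (A ∩ Set.Ioc (gridPoint a x n i : ℝ) (gridPoint a x n (i + 1))).Nonempty := by
  simp [RingsIn, gridPoint]

/-- Cut `(0, T]` into `n + 1` cells. Two given clocks both ring in a given cell with probability of
order `n⁻²`, so they share some cell with probability of order `n⁻¹`, which tends to `0`. -/
theorem IsClockFamily.ae_disjoint [IsProbabilityMeasure P] [Countable V]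
    (h : G.IsClockFamily P ring) :
    ∀ᵐ ω ∂P, ∀ e e', e ≠ e' → Disjoint (ring e ω) (ring e' ω) := by
  rw [ae_all_iff]; intro e
  rw [ae_all_iff]; intro e'
  by_cases hne : e = e'
  · simp [hne]
  have key (T : ℕ) : ∀ᵐ ω ∂P, ring e ω ∩ ring e' ω ∩ Set.Ioc 0 (T : ℝ) = ∅ := by
    rcases T.eq_zero_or_pos with rfl | hT
    · simp
    have hT' : (0 : ℝ) < T := by exact_mod_cast hT
    set C : ℝ := G.rate e.1 e.2 * T * (G.rate e'.1 e'.2 * T) with hC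
    have hle (n : ℕ) : P {ω | ¬ ring e ω ∩ ring e' ω ∩ Set.Ioc 0 (T : ℝ) = ∅} ≤
        ENNReal.ofReal (C * (1 / ((n : ℝ) + 1))) := by
      let B (e) (i : ℕ) : Set Ω :=
        {ω | (ring e ω ∩ Set.Ioc (gridPoint 0 T n i : ℝ) (gridPoint 0 T n (i + 1))).Nonempty}
      calc P {ω | ¬ ring e ω ∩ ring e' ω ∩ Set.Ioc 0 (T : ℝ) = ∅}
          ≤ P (⋃ i ∈ Finset.range (n + 1), B e i ∩ B e' i) := by
            refine measure_mono fun ω hω => ?_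
            obtain ⟨t, ⟨h1, h2⟩, h3, h4⟩ := Set.nonempty_iff_ne_empty.2 hω
            obtain ⟨i, hi, hti⟩ := exists_gridIndex_eq (a := 0) hT' h3 n
            have hlt : i < n + 1 := by
              have := gridIndex_mono (a := 0) hT' n h4
              have h5 := gridIndex_add (a := 0) hT' n
              rw [zero_add] at h5
              omega
            have hti' : t ∈ Set.Ioc (gridPoint 0 T n i : ℝ) (gridPoint 0 T n (i + 1)) := by
              simpa [gridPoint] using hti
            simp only [Set.mem_iUnion, Finset.mem_range]
            exact ⟨i, hlt, ⟨t, h1, hti'⟩, ⟨t, h2, hti'⟩⟩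
        _ ≤ ∑ i ∈ Finset.range (n + 1), P (B e i ∩ B e' i) := measure_biUnion_finset_le _ _
        _ ≤ ∑ i ∈ Finset.range (n + 1), ENNReal.ofReal (C * (1 / ((n : ℝ) + 1)) ^ 2) := by
            refine Finset.sum_le_sum fun i _ => ?_
            refine (h.measure_rings_inter_le hne (gridPoint_mono 0 T n i.le_succ)).trans_eq ?_
            congr 1
            simp only [gridPoint, hC]
            push_cast
            ring
        _ = ENNReal.ofReal (C * (1 / ((n : ℝ) + 1))) := by
            rw [Finset.sum_const, Finset.card_range, nsmul_eq_mul, ← ENNReal.ofReal_natCast,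
              ← ENNReal.ofReal_mul (by positivity)]
            congr 1
            push_cast
            field_simp
    have hlim : Tendsto (fun n : ℕ => ENNReal.ofReal (C * (1 / ((n : ℝ) + 1)))) atTop (𝓝 0) := by
      have := ENNReal.tendsto_ofReal (tendsto_one_div_add_atTop_nhds_zero_nat.const_mul C)
      simpa using this
    exact le_antisymm (ge_of_tendsto' hlim hle) zero_le
  filter_upwards [ae_all_iff.2 key] with ω hω _
  rw [Set.disjoint_iff_inter_eq_empty, Set.eq_empty_iff_forall_notMem]
  rintro t ⟨h1, h2⟩
  obtain ⟨T, hT⟩ := exists_nat_ge t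
  exact Set.eq_empty_iff_forall_notMem.1 (hω T) t
    ⟨⟨h1, h2⟩, (h.isPoissonClock e).pos ω h1, hT⟩

theorem IsClockFamily.ringIncr_ne_zero_iff (h : G.IsClockFamily P ring) {τ : ℕ → ℝ≥0}
    (hτ : Monotone τ) (p : (V × V) × ℕ) (ω : Ω) :
    ringIncr ring τ p ω ≠ 0 ↔ (ring p.1 ω ∩ Set.Ioc (τ p.2 : ℝ) (τ (p.2 + 1))).Nonempty :=
  (h.isPoissonClock p.1).ringCount_sub_ne_zero_iff (hτ p.2.le_succ) ω

theorem IsClockFamily.gridFresh_iff (h : G.IsClockFamily P ring) {τ : ℕ → ℝ≥0} (hτ : Monotone τ)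
    {a x : ℝ≥0} {n : ℕ} (hτg : ∀ i ≤ n + 1, τ i = gridPoint a x n i) (S : Set V) (ω : Ω) :
    G.GridFresh (fun e => ring e ω) S a x n ↔
      ∃ v ∈ S, gridReach G.source (fun e i => ringIncr ring τ (e, i) ω ≠ 0) (n + 1) v := by
  unfold GridFresh
  refine exists_congr fun v => and_congr_right fun _ => gridReach_congr (fun e i hi => ?_) v
  rw [h.ringIncr_ne_zero_iff hτ, ringsIn_iff, hτg i hi.le, hτg (i + 1) hi]

theorem IsClockFamily.measurableSet_gridFresh [Countable V] (h : G.IsClockFamily P ring)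
    {τ : ℕ → ℝ≥0} (hτ : Monotone τ) {a x : ℝ≥0} {n : ℕ}
    (hτg : ∀ i ≤ n + 1, τ i = gridPoint a x n i) (S : Set V) {m : MeasurableSpace Ω}
    (hm : ∀ e, ∀ i < n + 1, Measurable[m] (ringIncr ring τ (e, i))) :
    MeasurableSet[m] {ω | G.GridFresh (fun e => ring e ω) S a x n} := by
  have e : {ω | G.GridFresh (fun e => ring e ω) S a x n} =
      ⋃ v ∈ S, {ω | gridReach G.source (fun e i => ringIncr ring τ (e, i) ω ≠ 0) (n + 1) v} := by
    ext ω
    simpa using @IsClockFamily.gridFresh_iff V G Ω mΩ P ring h τ hτ a x n hτg S ω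
  rw [e]
  exact .biUnion S.to_countable fun v _ => measurableSet_gridReach
    (fun e i hi => hm e i hi (measurableSet_singleton 0).compl) v

/-- Every cell has length `x / (n + 1)` whatever `a` is, so the joint law of the increments, a
product of Poisson laws, does not depend on `a`. -/
theorem IsClockFamily.measure_gridFresh [Countable V] (h : G.IsClockFamily P ring) (S : Set V)
    (a x : ℝ≥0) (n : ℕ) :
    P {ω | G.GridFresh (fun e => ring e ω) S a x n} =
      P {ω | G.GridFresh (fun e => ring e ω) S 0 x n} := by
  have key (a : ℝ≥0) := (h.hasLaw_ringIncr (gridPoint_mono a x n)).measure_eq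
    (p := fun N => ∃ v ∈ S, gridReach G.source (fun e i => N (e, i) ≠ 0) (n + 1) v) <| by
      have e : {N : (V × V) × ℕ → ℕ | ∃ v ∈ S,
          gridReach G.source (fun e i => N (e, i) ≠ 0) (n + 1) v} =
          ⋃ v ∈ S, {N | gridReach G.source (fun e i => N (e, i) ≠ 0) (n + 1) v} := by
        ext; simp
      rw [e]
      exact .biUnion S.to_countable fun v _ => measurableSet_gridReach
        (fun e i _ => measurable_pi_apply (e, i) (measurableSet_singleton 0).compl) v
  have e (a : ℝ≥0) : (fun p : (V × V) × ℕ => poissonMeasure (G.rate p.1.1 p.1.2 *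
      (gridPoint a x n (p.2 + 1) - gridPoint a x n p.2))) =
      fun p => poissonMeasure (G.rate p.1.1 p.1.2 * (x / (n + 1))) := by
    funext p
    congr 2
    rw [tsub_eq_iff_eq_add_of_le (gridPoint_mono a x n p.2.le_succ)]
    simp only [gridPoint]
    push_cast
    ring
  simp only [e, ← h.gridFresh_iff (gridPoint_mono _ x n) fun _ _ => rfl] at key
  rw [key a, ← key 0]
  rfl

end GossipNetwork

/-! ### Stale events: stationarity, and independence of later rings -/

namespace GossipNetwork

variable {V : Type*} {G : GossipNetwork V} {Ω : Type*} {ring : V × V → Ω → Set ℝ}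

/-- The event that no clock in `K` rings in `(s, t]`. -/
def silentSet (ring : V × V → Ω → Set ℝ) (K : Set (V × V)) (s t : ℝ) : Set Ω :=
  {ω | ∀ e ∈ K, ¬ (ring e ω ∩ Set.Ioc s t).Nonempty}

variable (G) in
/-- The event that all packets that `S` has at time `t` left the source by time `a`. -/
def staleSet (ring : V × V → Ω → Set ℝ) (S : Set V) (a t : ℝ) : Set Ω :=
  {ω | ¬ G.HasFresh (fun e => ring e ω) S a t}

theorem silentSet_anti {K K' : Set (V × V)} (hK : K ⊆ K') (s t : ℝ) :
    silentSet ring K' s t ⊆ silentSet ring K s t :=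
  fun _ h e he => h e (hK he)

theorem staleSet_anti {S S' : Set V} (hS : S ⊆ S') {a t t' : ℝ} (ht : t ≤ t') :
    G.staleSet ring S' a t' ⊆ G.staleSet ring S a t :=
  fun _ h h' => h (h'.mono hS ht)

theorem staleSet_self (ring : V × V → Ω → Set ℝ) (S : Set V) (a : ℝ) :
    G.staleSet ring S a a = Set.univ := by
  refine Set.eq_univ_of_forall fun ω hω => ?_
  obtain ⟨v, -, s, hs, h⟩ := hω
  exact h.mem_Icc.2.not_gt hs

variable [mΩ : MeasurableSpace Ω] {P : Measure Ω}

theorem IsClockFamily.measure_silentSet_finset (h : G.IsClockFamily P ring) (K : Finset (V × V))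
    {s t : ℝ≥0} (hst : s ≤ t) :
    P (silentSet ring K s t) =
      ENNReal.ofReal (Real.exp (-((∑ e ∈ K, (G.rate e.1 e.2 : ℝ)) * (t - s)))) := by
  have hind := h.indep.comp (fun _ (c : ℝ≥0 → ℕ) => c t - c s) fun _ => by fun_prop
  have hs (e) : (fun x => ringCount (ring e x) t - ringCount (ring e x) s) ⁻¹' {0} =
      {ω | ¬ (ring e ω ∩ Set.Ioc (s : ℝ) t).Nonempty} := by
    ext ω
    exact not_iff_not.1 (by
      simpa using (h.isPoissonClock e).ringCount_sub_ne_zero_iff hst ω)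
  have := hind.measure_inter_preimage_eq_mul K (sets := fun _ => {0})
    fun _ _ => measurableSet_singleton 0
  simp only [Function.comp_def, hs, (h.isPoissonClock _).measure_silent hst] at this
  rw [← ENNReal.ofReal_prod_of_nonneg fun _ _ => (Real.exp_pos _).le, ← Real.exp_sum,
    Finset.sum_neg_distrib, ← Finset.sum_mul] at this
  rw [← this]
  congr 1
  ext; simp [silentSet]

theorem IsClockFamily.measure_silentSet_singleton (h : G.IsClockFamily P ring) (e : V × V)
    {s t : ℝ} (hs : 0 ≤ s) (hst : s ≤ t) :
    P (silentSet ring {e} s t) = ENNReal.ofReal (Real.exp (-(G.rate e.1 e.2 * (t - s)))) := by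
  have := h.measure_silentSet_finset {e} (Real.toNNReal_le_toNNReal hst)
  simpa [Real.coe_toNNReal _ hs, Real.coe_toNNReal _ (hs.trans hst)] using this

variable [Countable V]

theorem IsClockFamily.ae_eventually_gridFresh_iff [IsProbabilityMeasure P]
    (h : G.IsClockFamily P ring) {S : Set V} (hS : G.source ∉ S) (a x : ℝ≥0) :
    ∀ᵐ ω ∂P, ∀ᶠ n in atTop, (G.GridFresh (fun e => ring e ω) S a x n ↔
      G.HasFresh (fun e => ring e ω) S a (a + x)) := by
  filter_upwards [h.ae_disjoint] with ω hω
  by_cases hf : G.HasFresh (fun e => ring e ω) S a (a + x)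
  · have hx : (0 : ℝ) < x := by
      obtain ⟨v, -, s, hs, hv⟩ := hf
      linarith [hv.mem_Icc.2]
    filter_upwards [hf.eventually_gridFresh hω a.2 hx] with n hn
    exact iff_of_true hn hf
  · exact .of_forall fun n => iff_of_false (fun hn => hf (.of_gridFresh hS a.2 x.2 hn)) hf

theorem IsClockFamily.nullMeasurableSet_staleSet [IsProbabilityMeasure P]
    (h : G.IsClockFamily P ring) {S : Set V} (hS : G.source ∉ S) (a x : ℝ≥0) :
    NullMeasurableSet (G.staleSet ring S a (a + x)) P := by
  have hm (n : ℕ) := h.measurableSet_gridFresh (gridPoint_mono a x n) (fun _ _ => rfl) S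
    (fun e i _ => h.measurable_ringIncr _ (e, i))
  refine ((MeasurableSet.iUnion hm).compl.nullMeasurableSet).congr ?_
  filter_upwards [h.ae_eventually_gridFresh_iff hS a x] with ω hω
  refine propext (not_congr ?_)
  simp only [Set.mem_iUnion]
  refine ⟨fun ⟨n, hn⟩ => .of_gridFresh hS a.2 x.2 hn, fun hf => ?_⟩
  obtain ⟨n, hn⟩ := hω.exists
  exact ⟨n, hn.2 hf⟩

/-- The auxiliary event `H` serves two purposes: the whole space gives stationarity, and silence of
clocks after time `x` gives independence. -/
theorem IsClockFamily.tendsto_measure_gridStale [IsProbabilityMeasure P]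
    (h : G.IsClockFamily P ring) {S : Set V} (hS : G.source ∉ S) (a x : ℝ≥0) {H : Set Ω}
    (hH : MeasurableSet H) :
    Tendsto (fun n => P ({ω | ¬ G.GridFresh (fun e => ring e ω) S a x n} ∩ H)) atTop
      (𝓝 (P (G.staleSet ring S a (a + x) ∩ H))) := by
  have hm (n : ℕ) := h.measurableSet_gridFresh (gridPoint_mono a x n) (fun _ _ => rfl) S
    (fun e i _ => h.measurable_ringIncr _ (e, i))
  obtain ⟨T, hT, hTe⟩ := h.nullMeasurableSet_staleSet hS a x
  rw [measure_congr (hTe.inter (ae_eq_refl H))]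
  refine tendsto_measure_of_ae_tendsto_indicator_of_isFiniteMeasure atTop (hT.inter hH)
    (fun n => (hm n).compl.inter hH) ?_
  filter_upwards [h.ae_eventually_gridFresh_iff hS a x, hTe.mem_iff] with ω h1 h2
  filter_upwards [h1] with n hn
  exact and_congr_left fun _ => (not_congr hn).trans h2

theorem IsClockFamily.measure_staleSet_add [IsProbabilityMeasure P]
    (h : G.IsClockFamily P ring) {S : Set V} (hS : G.source ∉ S) (a x : ℝ≥0) :
    P (G.staleSet ring S a (a + x)) = P (G.staleSet ring S 0 x) := by
  have h1 (a : ℝ≥0) := h.tendsto_measure_gridStale hS a x MeasurableSet.univ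
  have h2 (a : ℝ≥0) (n : ℕ) : P ({ω | ¬ G.GridFresh (fun e => ring e ω) S a x n} ∩ Set.univ) =
      1 - P {ω | G.GridFresh (fun e => ring e ω) S 0 x n} := by
    rw [Set.inter_univ, ← h.measure_gridFresh S a x n]
    exact prob_compl_eq_one_sub (h.measurableSet_gridFresh (gridPoint_mono a x n)
      (fun _ _ => rfl) S (fun e i _ => h.measurable_ringIncr _ (e, i)))
  have h3 := tendsto_nhds_unique ((h1 a).congr (h2 a)) ((h1 0).congr (h2 0))
  simpa using h3

theorem IsClockFamily.measurableSet_silentSet (h : G.IsClockFamily P ring) (K : Set (V × V))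
    {s t : ℝ≥0} (hst : s ≤ t) : MeasurableSet (silentSet ring K s t) := by
  have e : silentSet ring K s t = ⋂ e ∈ K, {ω | ¬ (ring e ω ∩ Set.Ioc (s : ℝ) t).Nonempty} := by
    ext; simp [silentSet]
  rw [e]
  exact .biInter K.to_countable fun e _ => ((h.isPoissonClock e).measurableSet_rings hst).compl

/-- On a grid, staleness at time `x` depends on the increments before `x` and the silence on those
after `x`; the product formula for grids passes to the limit. -/
theorem IsClockFamily.measure_staleSet_inter_finset [IsProbabilityMeasure P]
    (h : G.IsClockFamily P ring) {S : Set V} (hS : G.source ∉ S) (x d : ℝ≥0)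
    (K : Finset (V × V)) :
    P (G.staleSet ring S 0 x ∩ silentSet ring K x (x + d)) =
      P (G.staleSet ring S 0 x) * P (silentSet ring K x (x + d)) := by
  have hH : MeasurableSet (silentSet ring K (x : ℝ) (x + d)) := by
    exact_mod_cast h.measurableSet_silentSet (K : Set (V × V)) (le_self_add : x ≤ x + d)
  have h1 := h.tendsto_measure_gridStale hS 0 x hH
  have h2 := h.tendsto_measure_gridStale hS 0 x MeasurableSet.univ
  simp only [Set.inter_univ, NNReal.coe_zero, zero_add] at h1 h2
  refine tendsto_nhds_unique h1 (Tendsto.congr (fun n => ?_)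
    (ENNReal.Tendsto.mul_const h2 (.inr (measure_ne_top _ _))))
  -- One partition for both events: the grid of `(0, x]` fills the intervals with index below `n +
  -- 1`, and the interval with index `n + 1` is `(x, x + d]`.
  let τ (i : ℕ) : ℝ≥0 := if i ≤ n + 1 then gridPoint 0 x n i else x + d
  have hx : gridPoint 0 x n (n + 1) = x := by
    simp only [gridPoint]
    push_cast
    field_simp
    simp
  have hτ : Monotone τ := by
    intro i j hij
    simp only [τ]
    split_ifs with h1 h2 h2
    · exact gridPoint_mono 0 x n hij
    · exact ((gridPoint_mono 0 x n h1).trans_eq hx).trans le_self_add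
    · omega
    · exact le_rfl
  have hτg : ∀ i ≤ n + 1, τ i = gridPoint 0 x n i := fun i hi => if_pos hi
  have hτ1 : τ (n + 1) = x := (hτg _ le_rfl).trans hx
  have hτ2 : τ (n + 1 + 1) = x + d := if_neg (by omega)
  have hind := indep_iSup_of_disjoint (m := fun p => MeasurableSpace.comap (ringIncr ring τ p) ⊤)
    (fun p => (h.measurable_ringIncr τ p).comap_le) (h.iIndepFun_ringIncr hτ).iIndep
    (S := {p | p.2 < n + 1}) (T := {p | p.2 = n + 1})
    (Set.disjoint_left.2 fun p hp hp' => by simp only [Set.mem_ofPred_eq] at hp hp'; omega)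
  have hle (T : Set ((V × V) × ℕ)) (p) (hp : p ∈ T) :
      Measurable[⨆ q ∈ T, MeasurableSpace.comap (ringIncr ring τ q) ⊤] (ringIncr ring τ p) :=
    Measurable.mono (comap_measurable _)
      (le_iSup₂ (f := fun q (_ : q ∈ T) => MeasurableSpace.comap (ringIncr ring τ q) ⊤) p hp) le_rfl
  have hA := @IsClockFamily.measurableSet_gridFresh V G Ω mΩ P ring _ h τ hτ 0 x n hτg S _
    fun e i hi => hle {p | p.2 < n + 1} (e, i) hi
  have e : silentSet ring K (x : ℝ) (x + d) = ⋂ e ∈ K, ringIncr ring τ (e, n + 1) ⁻¹' {0} := by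
    ext ω
    simp only [silentSet, Set.mem_iInter]
    refine forall₂_congr fun e _ => ?_
    have := h.ringIncr_ne_zero_iff hτ (e, n + 1) ω
    simp only [hτ1, hτ2] at this
    push_cast at this
    rw [← this, not_not]
    rfl
  rw [e]
  refine (((Indep_iff _ _ _).1 hind) _ _ hA.compl ?_).symm
  exact Finset.measurableSet_biInter _ fun e _ => hle {p | p.2 = n + 1} (e, n + 1) rfl
    (measurableSet_singleton 0)

/-- The rings after time `x` are independent of the packets received by time `x`. -/
theorem IsClockFamily.measure_staleSet_inter_silentSet [IsProbabilityMeasure P]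
    (h : G.IsClockFamily P ring) {S : Set V} (hS : G.source ∉ S) (x d : ℝ≥0)
    {K : Set (V × V)} {r : ℝ} (hK : HasSum (fun e : K => (G.rate e.1.1 e.1.2 : ℝ)) r) :
    P (G.staleSet ring S 0 x ∩ silentSet ring K x (x + d)) =
      P (G.staleSet ring S 0 x) * ENNReal.ofReal (Real.exp (-(r * d))) := by
  classical
  let F (s : Finset K) : Finset (V × V) := s.map (Function.Embedding.subtype _)
  -- Silence of an infinite `K` is the decreasing limit of the silence of its finite subsets, so
  -- continuity from above reduces to `measure_staleSet_inter_finset`.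
  have e : G.staleSet ring S 0 x ∩ silentSet ring K x (x + d) =
      ⋂ s, G.staleSet ring S 0 x ∩ silentSet ring (F s) x (x + d) := by
    rw [← Set.inter_iInter]
    congr 1
    ext ω
    simp only [silentSet, Set.mem_iInter]
    refine ⟨fun hω s e he => ?_, fun hω e he => ?_⟩
    · obtain ⟨e, -, rfl⟩ := Finset.mem_map.1 he
      exact hω _ e.2
    · exact hω {⟨e, he⟩} e (by simp [F])
  have hnull : NullMeasurableSet (G.staleSet ring S 0 x) P := by
    simpa using h.nullMeasurableSet_staleSet hS 0 x
  have h1 : Tendsto (fun s => P (G.staleSet ring S 0 x ∩ silentSet ring (F s) x (x + d))) atTop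
      (𝓝 (P (G.staleSet ring S 0 x ∩ silentSet ring K x (x + d)))) := by
    rw [e]
    refine tendsto_measure_iInter_atTop (fun s => hnull.inter ?_) (fun s t hst => ?_)
      ⟨∅, measure_ne_top _ _⟩
    · have := h.measurableSet_silentSet (F s : Set (V × V)) (le_self_add : x ≤ x + d)
      push_cast at this
      exact this.nullMeasurableSet
    · exact Set.inter_subset_inter_right _ (silentSet_anti (by
        exact_mod_cast Finset.map_subset_map.2 hst) _ _)
  refine tendsto_nhds_unique h1 ?_
  have h2 (s : Finset K) := h.measure_silentSet_finset (F s) (le_self_add : x ≤ x + d)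
  push_cast at h2
  simp only [h.measure_staleSet_inter_finset hS, h2, add_sub_cancel_left]
  refine ENNReal.Tendsto.const_mul (ENNReal.tendsto_ofReal ?_) (.inr (measure_ne_top _ _))
  refine (Real.continuous_exp.tendsto _).comp (Tendsto.neg (Tendsto.mul_const _ ?_))
  simpa [F, HasSum] using hK

end GossipNetwork

/-! ### A law from its truncations -/

/-- A family of laws that is consistent under truncation, and tight, has a limit. -/
theorem exists_measure_map_min (μ : ℝ → Measure ℝ) (hp : ∀ t, 0 ≤ t → IsProbabilityMeasure (μ t))
    (h0 : ∀ t, 0 ≤ t → μ t (Set.Iio 0) = 0)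
    (hc : ∀ t t', 0 ≤ t → t ≤ t' → (μ t').map (min · t) = μ t)
    (ht : Tendsto (fun t => μ t (Set.Ici t)) atTop (𝓝 0)) :
    ∃ law : Measure ℝ, IsProbabilityMeasure law ∧ ∀ t, 0 ≤ t → law.map (min · t) = μ t := by
  have hm (t : ℝ) : Measurable (min · t : ℝ → ℝ) := by fun_prop
  have hIic {t x : ℝ} (hx : x < t) : (min · t) ⁻¹' Set.Iic x = Set.Iic x := by
    ext y
    simp [hx.not_ge]
  have hIci {t x : ℝ} (hx : x ≤ t) : (min · t) ⁻¹' Set.Ici x = Set.Ici x := by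
    ext y
    simp [hx]
  have hle {t t' x : ℝ} (h0 : 0 ≤ t) (htt' : t ≤ t') (hx : x < t) :
      μ t (Set.Iic x) = μ t' (Set.Iic x) := by
    rw [← hc t t' h0 htt', Measure.map_apply (hm t) measurableSet_Iic, hIic hx]
  -- The distribution function at `x` can be read off from `μ t` for any `t ≥ 0` with `t > x`; `|x|
  -- + 1` is one such time.
  let f (x : ℝ) : ℝ := (μ (|x| + 1)).real (Set.Iic x)
  have hf {t x : ℝ} (h0 : 0 ≤ t) (hx : x < t) : f x = (μ t).real (Set.Iic x) := by
    simp only [f, measureReal_def]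
    congr 1
    have : x < |x| + 1 := (le_abs_self x).trans_lt (lt_add_one _)
    rcases le_total t (|x| + 1) with h | h
    · exact (hle h0 h hx).symm
    · exact hle (by positivity) h this
  have hmono : Monotone f := by
    intro x y hxy
    have h1 : x < |x| + |y| + 1 := by linarith [le_abs_self x, abs_nonneg y]
    have h2 : y < |x| + |y| + 1 := by linarith [le_abs_self y, abs_nonneg x]
    have := hp (|x| + |y| + 1) (by positivity)
    rw [hf (by positivity) h1, hf (by positivity) h2]
    exact measureReal_mono (Set.Iic_subset_Iic.2 hxy)
  have hright (x : ℝ) : ContinuousWithinAt f (Set.Ici x) x := by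
    have hx : x < |x| + 1 := (le_abs_self x).trans_lt (lt_add_one _)
    have := hp (|x| + 1) (by positivity)
    have hev : f =ᶠ[𝓝 x] cdf (μ (|x| + 1)) := by
      filter_upwards [gt_mem_nhds hx] with y hy
      rw [hf (by positivity) hy, cdf_eq_real]
    exact ((cdf (μ (|x| + 1))).right_continuous x).congr_of_eventuallyEq
      (hev.filter_mono nhdsWithin_le_nhds) hev.self_of_nhds
  have hbot : Tendsto f atBot (𝓝 0) := by
    refine tendsto_const_nhds.congr' ?_
    filter_upwards [eventually_lt_atBot 0] with x hx
    rw [hf le_rfl hx, measureReal_def,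
      measure_mono_null (Set.Iic_subset_Iio.2 hx) (h0 0 le_rfl), ENNReal.toReal_zero]
  have htop : Tendsto f atTop (𝓝 1) := by
    have h1 : Tendsto (fun t => 1 - (μ t).real (Set.Ici t)) atTop (𝓝 1) := by
      simpa [measureReal_def] using ((ENNReal.tendsto_toReal (by simp)).comp ht).const_sub 1
    refine tendsto_of_tendsto_of_tendsto_of_le_of_le' h1 tendsto_const_nhds ?_ ?_
    · filter_upwards [eventually_ge_atTop 0] with x hx
      have hx1 : x ≤ |x| + 1 := (le_abs_self x).trans (lt_add_one _).le
      have := hp (|x| + 1) (by positivity)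
      have e : (μ x).real (Set.Ici x) = (μ (|x| + 1)).real (Set.Ici x) := by
        rw [← hc x (|x| + 1) hx hx1, map_measureReal_apply (hm x) measurableSet_Ici, hIci le_rfl]
      have h2 := probReal_compl_eq_one_sub (μ := μ (|x| + 1)) (measurableSet_Ici (a := x))
      rw [e, ← h2, Set.compl_Ici]
      exact measureReal_mono Set.Iio_subset_Iic_self
    · filter_upwards with x
      have := hp (|x| + 1) (by positivity)
      exact measureReal_le_one
  let F : StieltjesFunction ℝ := ⟨f, hmono, hright⟩
  have hF : IsProbabilityMeasure F.measure := F.isProbabilityMeasure hbot htop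
  refine ⟨F.measure, hF, fun t h0 => ?_⟩
  have := hp t h0
  have := Measure.isProbabilityMeasure_map (μ := F.measure) (hm t).aemeasurable
  refine Measure.ext_of_Iic _ _ fun x => ?_
  rw [Measure.map_apply (hm t) measurableSet_Iic]
  rcases lt_or_ge x t with hx | hx
  · rw [hIic hx, F.measure_Iic hbot, sub_zero]
    change ENNReal.ofReal (f x) = _
    rw [hf h0 hx, ofReal_measureReal]
  · have e : (min · t) ⁻¹' Set.Iic x = Set.univ := by
      ext y
      simp [hx]
    -- Consistency of `μ t` with itself says that truncation at `t` does not change it, so it has no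
    -- mass above `t`.
    have e2 : μ t (Set.Iic x) = 1 := by
      rw [← hc t t h0 le_rfl, Measure.map_apply (hm t) measurableSet_Iic, e, measure_univ]
    rw [e, e2, measure_univ]

/-! ### Exponential tails and existence of the limiting age law -/

namespace GossipNetwork

variable {V : Type*} {G : GossipNetwork V} {Ω : Type*} {ring : V × V → Ω → Set ℝ}

theorem setOf_le_age {S : Set V} (hS : S.Nonempty) {t : ℝ} (ht : 0 ≤ t) (x : ℝ) :
    {ω | x ≤ G.age (fun e => ring e ω) S t} = G.staleSet ring S (t - x) t := by
  ext ω
  exact not_lt.symm.trans (not_congr (age_lt_iff _ hS ht))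

theorem Reaches.nonempty {S : Set V} (h : G.Reaches S) : S.Nonempty :=
  let ⟨v, hv, _⟩ := h; ⟨v, hv⟩

theorem Reaches.mono {S S' : Set V} (h : G.Reaches S) (hS : S ⊆ S') : G.Reaches S' :=
  let ⟨v, hv, hr⟩ := h; ⟨v, hS hv, hr⟩

variable [mΩ : MeasurableSpace Ω] {P : Measure Ω}

/-- Induction along a path from the source. Each further edge `(u, w)` is given the second half of
the time: if `u` is fresh by `x / 2` and the clock rings in `(x / 2, x]`, then `w` is fresh by `x`.
The source itself is the exceptional start, where one ring of its outgoing clock suffices. -/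
theorem IsClockFamily.measure_staleSet_singleton_le (h : G.IsClockFamily P ring) {v : V}
    (hr : Relation.ReflTransGen (fun u w => 0 < G.rate u w) G.source v) :
    v = G.source ∨ ∃ C c : ℝ, 0 < C ∧ 0 < c ∧ ∀ x, 0 ≤ x →
      P (G.staleSet ring {v} 0 x) ≤ ENNReal.ofReal (C * Real.exp (-(c * x))) := by
  induction hr with
  | refl => exact .inl rfl
  | @tail u w _ huw ih =>
    right
    have huw' : (0 : ℝ) < G.rate u w := by exact_mod_cast huw
    rcases ih with rfl | ⟨C, c, hC, hc, ih⟩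
    · refine ⟨1, G.rate G.source w, one_pos, huw', fun x hx => ?_⟩
      refine (measure_mono ?_).trans_eq (?_ : P (silentSet ring {(G.source, w)} 0 x) = _)
      · rintro ω hω e rfl ⟨t, ht, h1, h2⟩
        exact hω (hasFresh_of_source le_rfl ht h1 h2)
      · rw [h.measure_silentSet_singleton _ le_rfl hx]
        simp
    -- Both failure probabilities decay over a half interval, hence the halved minimum of the rates;
    -- `C` and `1` are their two prefactors.
    · refine ⟨C + 1, min c (G.rate u w) / 2, by positivity, by positivity, fun x hx => ?_⟩
      have hsub : G.staleSet ring {w} 0 x ⊆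
          G.staleSet ring {u} 0 (x / 2) ∪ silentSet ring {(u, w)} (x / 2) x := by
        intro ω hω
        by_contra hcon
        simp only [Set.mem_union, not_or, staleSet, silentSet, Set.mem_ofPred_eq, not_not,
          Set.mem_singleton_iff, forall_eq] at hcon
        obtain ⟨h1, t, ht, h2, h3⟩ := hcon
        exact hω (h1.recv h2.le ht h3)
      refine (measure_mono hsub).trans ((measure_union_le _ _).trans ?_)
      rw [h.measure_silentSet_singleton _ (by positivity) (by linarith), add_mul,
        ENNReal.ofReal_add (by positivity) (by positivity)]
      refine add_le_add ((ih _ (by positivity)).trans (ENNReal.ofReal_le_ofReal ?_))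
        (ENNReal.ofReal_le_ofReal ?_)
      · gcongr C * Real.exp (-?_)
        nlinarith [min_le_left c (G.rate u w)]
      · rw [one_mul]
        gcongr Real.exp (-?_)
        nlinarith [min_le_right c (G.rate u w : ℝ)]

theorem IsClockFamily.measure_staleSet_le (h : G.IsClockFamily P ring) {S : Set V}
    (hS : G.source ∉ S) (hr : G.Reaches S) :
    ∃ C c : ℝ, 0 < C ∧ 0 < c ∧ ∀ x, 0 ≤ x →
      P (G.staleSet ring S 0 x) ≤ ENNReal.ofReal (C * Real.exp (-(c * x))) := by
  obtain ⟨v, hv, hr⟩ := hr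
  rcases h.measure_staleSet_singleton_le hr with rfl | ⟨C, c, hC, hc, hle⟩
  · exact absurd hv hS
  · exact ⟨C, c, hC, hc, fun x hx =>
      (measure_mono (staleSet_anti (Set.singleton_subset_iff.2 hv) le_rfl)).trans (hle x hx)⟩

variable [IsProbabilityMeasure P] [Countable V]

/-- The right side is free of `t`: this is the time-invariance of the age. -/
theorem IsClockFamily.measure_le_age (h : G.IsClockFamily P ring) {S : Set V}
    (hS : G.source ∉ S) (hne : S.Nonempty) {t x : ℝ} (hx : 0 ≤ x) (hxt : x ≤ t) :
    P {ω | x ≤ G.age (fun e => ring e ω) S t} = P (G.staleSet ring S 0 x) := by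
  rw [setOf_le_age hne (hx.trans hxt)]
  have := h.measure_staleSet_add hS (t - x).toNNReal x.toNNReal
  simpa [Real.coe_toNNReal _ hx, Real.coe_toNNReal _ (sub_nonneg.2 hxt)] using this

theorem IsClockFamily.aemeasurable_age (h : G.IsClockFamily P ring) {S : Set V}
    (hS : G.source ∉ S) (hne : S.Nonempty) {t : ℝ} (ht : 0 ≤ t) :
    AEMeasurable (fun ω => G.age (fun e => ring e ω) S t) P := by
  refine NullMeasurable.aemeasurable ?_
  refine @measurable_of_Ici ℝ (NullMeasurableSpace Ω P) _ _ _ _ _ _ _ _ fun x => ?_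
  change NullMeasurableSet {ω | x ≤ G.age (fun e => ring e ω) S t} P
  rcases le_total x 0 with hx | hx
  · convert! nullMeasurableSet_univ
    exact Set.eq_univ_of_forall fun ω => hx.trans (age_nonneg _ S ht)
  rcases le_or_gt x t with hxt | hxt
  · rw [setOf_le_age hne ht]
    simpa [Real.coe_toNNReal _ hx, Real.coe_toNNReal _ (sub_nonneg.2 hxt)] using
      h.nullMeasurableSet_staleSet hS (t - x).toNNReal x.toNNReal
  · convert! nullMeasurableSet_empty
    exact Set.eq_empty_of_forall_notMem fun ω hω => ((age_le _ hne ht).trans_lt hxt).not_ge hω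

/-- Consistency of the truncations is time-invariance of the tails below `t`, together with the age
being at most `t`. Tightness is the exponential bound, since the age at time `t` equals `t` with
probability `q_S(t)`. -/
theorem IsClockFamily.exists_law (h : G.IsClockFamily P ring) {S : Set V}
    (hS : G.source ∉ S) (hr : G.Reaches S) :
    ∃ law : Measure ℝ, IsProbabilityMeasure law ∧ ∀ t, 0 ≤ t →
      law.map (min · t) = P.map (fun ω => G.age (fun e => ring e ω) S t) := by
  have hne := hr.nonempty
  have hm (t : ℝ) (ht : 0 ≤ t) := h.aemeasurable_age hS hne ht
  have happ (t x : ℝ) (ht : 0 ≤ t) : P.map (fun ω => G.age (fun e => ring e ω) S t) (Set.Ici x) =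
      P {ω | x ≤ G.age (fun e => ring e ω) S t} :=
    Measure.map_apply_of_aemeasurable (hm t ht) measurableSet_Ici
  refine exists_measure_map_min _ (fun t ht => Measure.isProbabilityMeasure_map (hm t ht)) ?_ ?_ ?_
  · intro t ht
    rw [Measure.map_apply_of_aemeasurable (hm t ht) measurableSet_Iio]
    convert! measure_empty (μ := P)
    exact Set.eq_empty_of_forall_notMem fun ω hω => (age_nonneg _ S ht).not_gt hω
  · intro t t' ht htt'
    have ht' := ht.trans htt'
    have := Measure.isProbabilityMeasure_map (hm t ht)
    have := Measure.isProbabilityMeasure_map (hm t' ht')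
    have hmin : Measurable (min · t : ℝ → ℝ) := by fun_prop
    have := Measure.isProbabilityMeasure_map
      (μ := P.map (fun ω => G.age (fun e => ring e ω) S t')) hmin.aemeasurable
    refine Measure.ext_of_Ici _ _ fun x => ?_
    rw [Measure.map_apply hmin measurableSet_Ici]
    rcases le_or_gt x t with hxt | hxt
    · have e : (min · t) ⁻¹' Set.Ici x = Set.Ici x := by
        ext y
        simp [hxt]
      rw [e, happ _ _ ht', happ _ _ ht]
      rcases le_total 0 x with hx | hx
      · rw [h.measure_le_age hS hne hx hxt, h.measure_le_age hS hne hx (hxt.trans htt')]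
      · congr 1
        ext ω
        exact iff_of_true (hx.trans (age_nonneg _ S ht')) (hx.trans (age_nonneg _ S ht))
    · have e : (min · t) ⁻¹' Set.Ici x = ∅ := by
        ext y
        simp [hxt]
      rw [e, happ _ _ ht, measure_empty]
      convert! (measure_empty (μ := P)).symm
      exact Set.eq_empty_of_forall_notMem fun ω hω => ((age_le _ hne ht).trans_lt hxt).not_ge hω
  · obtain ⟨C, c, hC, hc, hle⟩ := h.measure_staleSet_le hS hr
    have h1 : Tendsto (fun x => ENNReal.ofReal (C * Real.exp (-(c * x)))) atTop (𝓝 0) := by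
      have := (Real.tendsto_exp_neg_atTop_nhds_zero.comp
        (tendsto_id.const_mul_atTop hc)).const_mul C
      simpa using ENNReal.tendsto_ofReal this
    refine tendsto_of_tendsto_of_tendsto_of_le_of_le' tendsto_const_nhds h1
      (.of_forall fun _ => zero_le) ?_
    filter_upwards [eventually_ge_atTop 0] with t ht
    rw [happ _ _ ht, h.measure_le_age hS hne ht le_rfl]
    exact hle t ht

end GossipNetwork

/-! ### Short-time bounds for the tail of the age -/

namespace GossipNetwork

variable {V : Type*} {G : GossipNetwork V}

variable (G) in
/-- The rate of an edge, and `0` for edges outside `K`. -/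
noncomputable def rateOn (K : Set (V × V)) : V × V → ℝ :=
  K.indicator fun e => (G.rate e.1 e.2 : ℝ)

theorem rateOn_nonneg (K : Set (V × V)) (e : V × V) : 0 ≤ G.rateOn K e :=
  Set.indicator_nonneg (fun _ _ => NNReal.coe_nonneg _) e

/-- The pairs of vertices that enter `S`. -/
def inPairs (S : Set V) : Set (V × V) := {e | e.1 ∉ S ∧ e.2 ∈ S}

theorem boundary_subset_inPairs (S : Set V) : G.boundary S ⊆ inPairs S :=
  fun _ he => ⟨he.2.1, he.2.2.1⟩

/-- A pair entering `S` starts at the source, lies in `boundary`, or has rate `0`. So the total rate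
into `S` is a single sum over `inPairs S`, the form in which it appears as a silence exponent. -/
theorem hasSum_rateOn_inPairs {S : Set V} (hS : G.source ∉ S) (hfin : G.FiniteInRate S) :
    HasSum (G.rateOn (inPairs S)) (G.inRate S) := by
  have h1 : HasSum (G.rateOn {e | e.1 = G.source ∧ e.2 ∈ S})
      (∑' v : S, (G.rate G.source v : ℝ)) := by
    let g (v : S) : V × V := (G.source, v)
    have hg : Function.Injective g := fun v w h => Subtype.ext (congrArg Prod.snd h)
    rw [← hg.hasSum_iff]
    · convert! hfin.1.hasSum using 1
      funext v
      have hv : g v ∈ {e : V × V | e.1 = G.source ∧ e.2 ∈ S} := ⟨rfl, v.2⟩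
      exact Set.indicator_of_mem hv fun e => (G.rate e.1 e.2 : ℝ)
    · rintro ⟨u, v⟩ he
      refine Set.indicator_of_notMem ?_ _
      rintro ⟨rfl, h⟩
      exact he ⟨⟨v, h⟩, rfl⟩
  have h2 : HasSum (G.rateOn (G.boundary S)) (∑' e : G.boundary S, (G.rate e.1.1 e.1.2 : ℝ)) :=
    hasSum_subtype_iff_indicator.1 hfin.2.hasSum
  convert! h1.add h2 using 1
  funext e
  classical
  simp only [rateOn, Set.indicator_apply, inPairs, boundary, Set.mem_ofPred_eq]
  by_cases hs : e.1 = G.source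
  · simp [hs, hS]
  · rcases eq_zero_or_pos (G.rate e.1 e.2) with h0 | h0
    · simp [h0]
    · simp [hs, h0]

theorem summable_rateOn_into (u : V) : Summable (G.rateOn {e | e.2 = u}) := by
  refine summable_of_hasFiniteSupport (((G.finite_in u).image fun w => (w, u)).subset ?_)
  rintro ⟨w, v⟩ he
  classical
  simp only [Function.mem_support, rateOn, Set.indicator_apply, Set.mem_ofPred_eq, ne_eq,
    ite_eq_right_iff, Classical.not_imp, NNReal.coe_eq_zero] at he
  obtain ⟨rfl, he⟩ := he
  exact ⟨w, pos_iff_ne_zero.2 he, rfl⟩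

/-- A path from outside `S` to a vertex of `S` crosses into `S` along some edge, and the rate of
that edge is one term of the sum. -/
theorem inRate_pos {S : Set V} (hS : G.source ∉ S) (hr : G.Reaches S) (hfin : G.FiniteInRate S) :
    0 < G.inRate S := by
  obtain ⟨v, hv, hr⟩ := hr
  have h : ∃ u ∉ S, ∃ w ∈ S, 0 < G.rate u w := by
    induction hr with
    | refl => exact absurd hv hS
    | @tail u w _ huw ih =>
      by_cases hu : u ∈ S
      · exact ih hu
      · exact ⟨u, hu, w, hv, huw⟩
  obtain ⟨u, hu, w, hw, h⟩ := h
  have h1 := le_hasSum (hasSum_rateOn_inPairs hS hfin) (u, w) fun e _ => rateOn_nonneg _ e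
  rw [rateOn, Set.indicator_of_mem (show (u, w) ∈ inPairs S from ⟨hu, hw⟩)] at h1
  exact lt_of_lt_of_le (by exact_mod_cast h) h1

theorem source_notMem_union {S : Set V} (hS : G.source ∉ S) {e : V × V} (he : e ∈ G.boundary S) :
    G.source ∉ S ∪ {e.1, e.2} := by
  rintro (h | h | h)
  · exact hS h
  · exact he.2.2.2 h.symm
  · exact hS ((show G.source = e.2 from h) ▸ he.2.2.1)

variable {Ω : Type*} {ring : V × V → Ω → Set ℝ} [mΩ : MeasurableSpace Ω] {P : Measure Ω}
  [Countable V]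

theorem IsClockFamily.measurableSet_silentSet_add (h : G.IsClockFamily P ring) (K : Set (V × V))
    (x d : ℝ≥0) : MeasurableSet (silentSet ring K (x : ℝ) (x + d)) := by
  exact_mod_cast h.measurableSet_silentSet K (le_self_add : x ≤ x + d)

variable [IsProbabilityMeasure P]

theorem IsClockFamily.nullMeasurableSet_staleSet_zero (h : G.IsClockFamily P ring) {S : Set V}
    (hS : G.source ∉ S) (x : ℝ≥0) : NullMeasurableSet (G.staleSet ring S 0 x) P := by
  simpa using h.nullMeasurableSet_staleSet hS 0 x

theorem IsClockFamily.measure_staleSet_inter_silentSet' (h : G.IsClockFamily P ring) {S : Set V}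
    (hS : G.source ∉ S) (x d : ℝ≥0) {K : Set (V × V)} {r : ℝ} (hK : HasSum (G.rateOn K) r) :
    P (G.staleSet ring S 0 x ∩ silentSet ring K x (x + d)) =
      P (G.staleSet ring S 0 x) * ENNReal.ofReal (Real.exp (-(r * d))) :=
  h.measure_staleSet_inter_silentSet hS x d (hasSum_subtype_iff_indicator.2 hK)

/-- The difference of the silent events says that `e` rings while all of `K` is silent; subtracting
the two exponentials gives the probability. -/
theorem IsClockFamily.measure_staleSet_inter_sdiff (h : G.IsClockFamily P ring) {S : Set V}
    (hS : G.source ∉ S) (x d : ℝ≥0) {K : Set (V × V)} {e : V × V} (he : e ∉ K) {r : ℝ}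
    (hK : HasSum (G.rateOn K) r) :
    P (G.staleSet ring S 0 x ∩
        (silentSet ring K x (x + d) \ silentSet ring (insert e K) x (x + d))) =
      P (G.staleSet ring S 0 x) *
        ENNReal.ofReal ((1 - Real.exp (-(G.rate e.1 e.2 * d))) * Real.exp (-(r * d))) := by
  classical
  have hK' : HasSum (G.rateOn (insert e K)) (G.rate e.1 e.2 + r) := by
    have h1 : HasSum (fun e' => if e' = e then (G.rate e.1 e.2 : ℝ) else 0) (G.rate e.1 e.2 : ℝ) :=
      hasSum_ite_eq e _
    convert! h1.add hK using 1
    funext e'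
    by_cases h' : e' = e
    · subst h'
      simp [rateOn, he]
    · simp [rateOn, Set.indicator_apply, h']
  rw [Set.inter_sdiff_distrib_left, measure_sdiff
    (Set.inter_subset_inter_right _ (silentSet_anti (Set.subset_insert _ _) _ _))
    ((h.nullMeasurableSet_staleSet_zero hS x).inter
      (h.measurableSet_silentSet_add _ x d).nullMeasurableSet) (measure_ne_top _ _),
    h.measure_staleSet_inter_silentSet' hS x d hK, h.measure_staleSet_inter_silentSet' hS x d hK',
    ← ENNReal.mul_sub fun _ _ => measure_ne_top _ _, ← ENNReal.ofReal_sub _ (Real.exp_pos _).le]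
  congr 2
  rw [add_mul, neg_add, Real.exp_add]
  ring

/-- If `S` is stale at `x + d`, either no clock into `S` rang after `x`, or one of `boundary` did
and both its ends were stale at `x` along with `S`. A union bound over the edges suffices, because
simultaneous contributions are of higher order in `d`. -/
theorem IsClockFamily.measure_staleSet_add_le (h : G.IsClockFamily P ring) {S : Set V}
    (hS : G.source ∉ S) (hfin : G.FiniteInRate S) (x d : ℝ≥0) :
    P (G.staleSet ring S 0 (x + d)) ≤
      P (G.staleSet ring S 0 x) * ENNReal.ofReal (Real.exp (-(G.inRate S * d))) +
        ∑' e : G.boundary S, P (G.staleSet ring (S ∪ {e.1.1, e.1.2}) 0 x) *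
          ENNReal.ofReal (1 - Real.exp (-(G.rate e.1.1 e.1.2 * d))) := by
  -- Pairs of rate `0` are in `inPairs S` but not in `boundary`; almost surely none of them rings in
  -- the interval.
  have hae : ∀ᵐ ω ∂P, ∀ e : V × V, G.rate e.1 e.2 = 0 → ω ∈ silentSet ring {e} x (x + d) := by
    rw [ae_all_iff]
    intro e
    by_cases he : G.rate e.1 e.2 = 0
    · have h1 := h.measure_silentSet_singleton e x.2 (le_add_of_nonneg_right (a := (x : ℝ)) d.2)
      have h2 : P (silentSet ring {e} x (x + d))ᶜ = 0 := by
        rw [prob_compl_eq_zero_iff (h.measurableSet_silentSet_add _ x d)]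
        simpa [he] using h1
      filter_upwards [measure_eq_zero_iff_ae_notMem.1 h2] with ω hω _
      exact not_not.1 hω
    · exact .of_forall fun ω he' => absurd he' he
  have hsub : G.staleSet ring S 0 (x + d) ≤ᵐ[P]
      ((G.staleSet ring S 0 x ∩ silentSet ring (inPairs S) x (x + d)) ∪
        ⋃ e : G.boundary S, G.staleSet ring (S ∪ {e.1.1, e.1.2}) 0 x ∩
          (silentSet ring ∅ x (x + d) \ silentSet ring (insert e.1 ∅) x (x + d)) : Set Ω) := by
    filter_upwards [hae] with ω hω hstale
    by_cases hsil : ω ∈ silentSet ring (inPairs S) x (x + d)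
    · exact .inl ⟨staleSet_anti subset_rfl (le_add_of_nonneg_right d.2) hstale, hsil⟩
    right
    simp only [silentSet, Set.mem_ofPred_eq, not_forall, not_not] at hsil
    obtain ⟨e, he, hring⟩ := hsil
    obtain ⟨t, ht, h1, h2⟩ := id hring
    have hsrc : e.1 ≠ G.source := by
      intro hsrc
      refine hstale (HasFresh.mono (S := {e.2})
        (hasFresh_of_source (t := t) le_rfl ?_ (x.2.trans_lt h1) h2)
        (Set.singleton_subset_iff.2 he.2) le_rfl)
      rw [← hsrc]
      exact ht
    have hpos : 0 < G.rate e.1 e.2 := by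
      refine pos_iff_ne_zero.2 fun h0 => ?_
      exact hω e h0 e rfl hring
    refine Set.mem_iUnion.2 ⟨⟨e, hpos, he.1, he.2, hsrc⟩, ?_, fun _ h => h.elim, fun hcon =>
      hcon e (Set.mem_insert _ _) hring⟩
    -- A packet fresh at `e.1` by time `x` would be handed to `e.2` at the ring time `t`, making `S`
    -- fresh.
    rintro ⟨v, hv, s, hs, hst⟩
    have hxt : (x : ℝ) ≤ t := h1.le
    rcases hv with hv | rfl | rfl
    · exact hstale ⟨v, hv, s, hs, hst.keep (le_add_of_nonneg_right d.2)⟩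
    · exact hstale ⟨e.2, he.2, s, hs, ((hst.keep hxt).recv ht).keep h2⟩
    · exact hstale ⟨_, he.2, s, hs, hst.keep (le_add_of_nonneg_right d.2)⟩
  refine (measure_mono_ae hsub).trans ((measure_union_le _ _).trans ?_)
  refine add_le_add (h.measure_staleSet_inter_silentSet' hS x d
    (hasSum_rateOn_inPairs hS hfin)).le ((measure_iUnion_le _).trans_eq ?_)
  refine tsum_congr fun e => ?_
  rw [h.measure_staleSet_inter_sdiff (source_notMem_union hS e.2) x d (Set.notMem_empty _) (r := 0)
    (by simp [rateOn])]
  simp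

variable (G) in
/-- The total rate of updates into the vertex `u`. -/
noncomputable def totalRate (u : V) : ℝ := ∑' e, G.rateOn {e | e.2 = u} e

/-- Disjoint ways for `S` to be stale at `x + d`: no clock into `S` rings, or `e` is the only one
that does, no clock into `e.1` rings, and `S ∪ e` was stale at `x`. Requiring silence into `e.1`
keeps `S ∪ e` stale and costs only the factor with `totalRate`, which tends to `1` as `d → 0`. -/
theorem IsClockFamily.le_measure_staleSet_add (h : G.IsClockFamily P ring) {S : Set V}
    (hS : G.source ∉ S) (hfin : G.FiniteInRate S) (x d : ℝ≥0) :
    P (G.staleSet ring S 0 x) * ENNReal.ofReal (Real.exp (-(G.inRate S * d))) +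
        ∑' e : G.boundary S, P (G.staleSet ring (S ∪ {e.1.1, e.1.2}) 0 x) *
          ENNReal.ofReal ((1 - Real.exp (-(G.rate e.1.1 e.1.2 * d))) *
            Real.exp (-((G.inRate S + G.totalRate e.1.1) * d))) ≤
      P (G.staleSet ring S 0 (x + d)) := by
  have hD := hasSum_rateOn_inPairs hS hfin
  -- Silence of `K e` blocks every pair that enters `S ∪ e` from outside; since `K e` also contains
  -- all other pairs into `S`, the events `B e` are disjoint.
  let K (e : V × V) : Set (V × V) := (inPairs S ∪ {a | a.2 = e.1}) \ {e}
  have hKe (e) : e ∉ K e := fun h => h.2 rfl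
  have hKle (e a) : G.rateOn (K e) a ≤ G.rateOn (inPairs S) a + G.rateOn {a | a.2 = e.1} a := by
    classical
    have h1 := rateOn_nonneg (G := G) (inPairs S) a
    have h2 := rateOn_nonneg (G := G) {a | a.2 = e.1} a
    by_cases ha : a ∈ K e
    · rcases ha.1 with ha' | ha'
      · simpa [rateOn, ha, ha'] using h2
      · have e1 : G.rateOn {a | a.2 = e.1} a = G.rateOn (K e) a := by
          rw [rateOn, rateOn, Set.indicator_of_mem ha', Set.indicator_of_mem ha]
        linarith
    · rw [rateOn, Set.indicator_of_notMem ha]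
      exact add_nonneg h1 h2
  have hsum (e : V × V) := hD.summable.add (summable_rateOn_into (G := G) e.1)
  have hKs (e) : Summable (G.rateOn (K e)) := (hsum e).of_nonneg_of_le (rateOn_nonneg _) (hKle e)
  have hKt (e) : ∑' a, G.rateOn (K e) a ≤ G.inRate S + G.totalRate e.1 := by
    refine ((hKs e).tsum_le_tsum (hKle e) (hsum e)).trans_eq ?_
    rw [hD.summable.tsum_add (summable_rateOn_into _), hD.tsum_eq]
    rfl
  let A : Set Ω := G.staleSet ring S 0 x ∩ silentSet ring (inPairs S) x (x + d)
  let B (e : G.boundary S) : Set Ω := G.staleSet ring (S ∪ {e.1.1, e.1.2}) 0 x ∩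
    (silentSet ring (K e) x (x + d) \ silentSet ring (insert e.1 (K e)) x (x + d))
  have hBring (e : G.boundary S) (ω) (hω : ω ∈ B e) :
      (ring e ω ∩ Set.Ioc (x : ℝ) (x + d)).Nonempty := by
    by_contra hcon
    refine hω.2.2 fun e' he' => ?_
    rcases he' with rfl | he'
    · exact hcon
    · exact hω.2.1 e' he'
  have hBnull (e : G.boundary S) : NullMeasurableSet (B e) P :=
    (h.nullMeasurableSet_staleSet_zero (source_notMem_union hS e.2) x).inter
      (MeasurableSet.diff (h.measurableSet_silentSet_add _ x d)
        (h.measurableSet_silentSet_add _ x d)).nullMeasurableSet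
  have hBdisj : Pairwise fun e e' : G.boundary S => Disjoint (B e) (B e') := by
    refine fun e e' hne => Set.disjoint_left.2 fun ω hω hω' => ?_
    refine hω'.2.1 e ⟨.inl (boundary_subset_inPairs S e.2), fun h' => hne (Subtype.ext h')⟩
      (hBring e ω hω)
  have hAB : Disjoint A (⋃ e, B e) := by
    refine Set.disjoint_left.2 fun ω hA hB => ?_
    obtain ⟨e, he⟩ := Set.mem_iUnion.1 hB
    exact hA.2 e (boundary_subset_inPairs S e.2) (hBring e ω he)
  have hxd : (x : ℝ) ≤ x + d := le_add_of_nonneg_right d.2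
  calc _ ≤ P A + ∑' e, P (B e) := by
        refine add_le_add (h.measure_staleSet_inter_silentSet' hS x d hD).ge
          (ENNReal.tsum_le_tsum fun e => ?_)
        simp only [B]
        rw [h.measure_staleSet_inter_sdiff (source_notMem_union hS e.2) x d (hKe e)
          (hKs e).hasSum]
        gcongr
        · simp only [sub_nonneg, Real.exp_le_one_iff, Left.neg_nonpos_iff]
          positivity
        · exact hKt e
    _ = P (A ∪ ⋃ e, B e) := by
        rw [measure_union₀ (.iUnion hBnull) hAB.aedisjoint,
          measure_iUnion₀ (fun e e' hne => (hBdisj hne).aedisjoint) hBnull]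
    _ ≤ P (G.staleSet ring S 0 (x + d)) := by
        refine measure_mono ?_
        rintro ω (hω | hω) hf
        · refine hω.1 (hf.of_silent hS x.2 hxd fun u hu w hw t ht hring => ?_)
          exact hω.2 (u, w) ⟨hu, hw⟩ ⟨t, hring, ht⟩
        · obtain ⟨e, he⟩ := Set.mem_iUnion.1 hω
          refine he.1 ((hf.mono Set.subset_union_left le_rfl).of_silent
            (source_notMem_union hS e.2) x.2 hxd fun u hu w hw t ht hring => ?_)
          simp only [Set.mem_union, Set.mem_insert_iff, Set.mem_singleton_iff, not_or] at hu
          refine he.2.1 (u, w) ⟨?_, fun h' => hu.2.1 (congrArg Prod.fst h')⟩ ⟨t, hring, ht⟩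
          rcases hw with hw | hw | hw
          · exact .inl ⟨hu.1, hw⟩
          · exact .inr hw
          · refine .inl ⟨hu.1, ?_⟩
            rw [show w = e.1.2 from hw]
            exact e.2.2.2.1

end GossipNetwork

/-! ### Moments from tails, and difference quotients as the step tends to zero -/

theorem measurable_measure_Ici (μ : Measure ℝ) : Measurable fun x => μ (Set.Ici x) :=
  Antitone.measurable fun _ _ h => measure_mono (Set.Ici_subset_Ici.2 h)

/-- Layer-cake formula: shifting the tail by `d` corresponds to the moment of the positive part of
`y - d`. -/
theorem lintegral_posPart_sub_pow (μ : Measure ℝ) (d : ℝ) (k : ℕ) :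
    ∫⁻ y, ENNReal.ofReal (max (y - d) 0 ^ (k + 1)) ∂μ =
      ∫⁻ x in Set.Ioi 0, μ (Set.Ici (x + d)) * ENNReal.ofReal ((k + 1) * x ^ k) := by
  have h := lintegral_comp_eq_lintegral_meas_le_mul μ (f := fun y => max (y - d) 0)
    (g := fun x => ((k : ℝ) + 1) * x ^ k) (.of_forall fun y => le_max_right _ _)
    (by fun_prop) (fun t _ => (by fun_prop : Continuous _).intervalIntegrable _ _)
    (by
      filter_upwards [ae_restrict_mem measurableSet_Ioi] with x hx
      have : (0 : ℝ) < x := hx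
      positivity)
  have e (a : ℝ) : ∫ x in (0 : ℝ)..a, ((k : ℝ) + 1) * x ^ k = a ^ (k + 1) := by
    rw [intervalIntegral.integral_const_mul, integral_pow]
    field_simp
    simp
  simp only [e] at h
  rw [h]
  refine setLIntegral_congr_fun measurableSet_Ioi fun x hx => ?_
  have hx : (0 : ℝ) < x := hx
  congr 2
  ext y
  simp only [Set.mem_ofPred_eq, le_max_iff, Set.mem_Ici, hx.not_ge, or_false]
  exact le_sub_iff_add_le

theorem integrable_pow_of_measure_Ici_le {μ : Measure ℝ} [IsFiniteMeasure μ]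
    (h0 : ∀ᵐ y ∂μ, 0 ≤ y) {C c : ℝ} (hC : 0 < C) (hc : 0 < c)
    (h : ∀ x, 0 ≤ x → μ (Set.Ici x) ≤ ENNReal.ofReal (C * Real.exp (-(c * x)))) (k : ℕ) :
    Integrable (fun y => y ^ k) μ := by
  cases k with
  | zero => simp
  | succ k =>
    refine ⟨by fun_prop, ?_⟩
    rw [hasFiniteIntegral_iff_norm]
    have e : ∫⁻ y, ENNReal.ofReal ‖y ^ (k + 1)‖ ∂μ =
        ∫⁻ y, ENNReal.ofReal (max (y - 0) 0 ^ (k + 1)) ∂μ := by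
      refine lintegral_congr_ae ?_
      filter_upwards [h0] with y hy
      rw [Real.norm_of_nonneg (by positivity), sub_zero, max_eq_left hy]
    rw [e, lintegral_posPart_sub_pow]
    have hint : IntegrableOn (fun x : ℝ => (C * Real.exp (-(c * x))) * ((k + 1) * x ^ k))
        (Set.Ioi 0) := by
      have h1 := (integrableOn_rpow_mul_exp_neg_mul_rpow (p := 1) (s := k)
        (by linarith [k.cast_nonneg (α := ℝ)]) one_pos hc).const_mul (C * (k + 1))
      refine IntegrableOn.congr_fun h1 (fun x _ => ?_) measurableSet_Ioi
      simp only [Real.rpow_one, Real.rpow_natCast, neg_mul]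
      ring
    refine lt_of_le_of_lt (setLIntegral_mono' measurableSet_Ioi fun x hx => ?_)
      hint.lintegral_lt_top
    have hx : (0 : ℝ) < x := hx
    rw [add_zero, ENNReal.ofReal_mul (p := C * Real.exp (-(c * x))) (by positivity)]
    exact mul_le_mul' (h x hx.le) le_rfl

theorem tendsto_integral_min_pow {μ : Measure ℝ} (h0 : ∀ᵐ y ∂μ, 0 ≤ y) {k : ℕ}
    (hk : Integrable (fun y => y ^ k) μ) :
    Tendsto (fun t : ℝ => ∫ y, min y t ^ k ∂μ) atTop (𝓝 (∫ y, y ^ k ∂μ)) := by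
  refine tendsto_integral_filter_of_dominated_convergence (fun y => y ^ k)
    (.of_forall fun t => by fun_prop) ?_ hk (.of_forall fun y => ?_)
  · filter_upwards [eventually_ge_atTop 0] with t ht
    filter_upwards [h0] with y hy
    have := le_min hy ht
    rw [Real.norm_of_nonneg (by positivity)]
    gcongr
    exact min_le_left _ _
  · refine tendsto_const_nhds.congr' ?_
    filter_upwards [eventually_ge_atTop y] with t ht
    rw [min_eq_left ht]

theorem integrable_posPart_sub_pow {μ : Measure ℝ} (h0 : ∀ᵐ y ∂μ, 0 ≤ y) {k : ℕ}
    (hk : Integrable (fun y => y ^ k) μ) {d : ℝ} (hd : 0 ≤ d) :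
    Integrable (fun y => max (y - d) 0 ^ k) μ := by
  refine hk.mono' (by fun_prop) ?_
  filter_upwards [h0] with y hy
  rw [Real.norm_of_nonneg (by positivity)]
  gcongr
  exact max_le (by linarith) hy

/-- Pointwise the derivative is `-(k + 1) * y ^ k`, and the quotients are dominated by `(k + 1) * y
^ k`. Strict positivity of `y` matters when `k = 0`: an atom at `0` would contribute slope `0` in
place of `-1`. -/
theorem tendsto_slope_integral_posPart_sub_pow {μ : Measure ℝ} (h0 : ∀ᵐ y ∂μ, 0 < y) {k : ℕ}
    (hk : Integrable (fun y => y ^ k) μ) (hk1 : Integrable (fun y => y ^ (k + 1)) μ) :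
    Tendsto (fun d : ℝ => d⁻¹ * (∫ y, max (y - d) 0 ^ (k + 1) ∂μ - ∫ y, y ^ (k + 1) ∂μ))
      (𝓝[>] 0) (𝓝 (-((k + 1) * ∫ y, y ^ k ∂μ))) := by
  have h0' : ∀ᵐ y ∂μ, 0 ≤ y := h0.mono fun _ h => h.le
  have e : (fun d : ℝ => d⁻¹ * (∫ y, max (y - d) 0 ^ (k + 1) ∂μ - ∫ y, y ^ (k + 1) ∂μ)) =ᶠ[𝓝[>] 0]
      fun d => ∫ y, d⁻¹ * (max (y - d) 0 ^ (k + 1) - y ^ (k + 1)) ∂μ := by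
    filter_upwards [self_mem_nhdsWithin] with d hd
    rw [integral_const_mul, integral_sub (integrable_posPart_sub_pow h0' hk1 (le_of_lt hd)) hk1]
  rw [← integral_const_mul, ← integral_neg]
  refine Tendsto.congr' e.symm ?_
  refine tendsto_integral_filter_of_dominated_convergence (fun y => ((k : ℝ) + 1) * y ^ k)
    (.of_forall fun t => by fun_prop) ?_ (hk.const_mul _) ?_
  · filter_upwards [self_mem_nhdsWithin] with d hd
    have hd : 0 < d := hd
    filter_upwards [h0'] with y hy
    have h1 : |max (y - d) 0| ≤ y := by
      rw [abs_of_nonneg (le_max_right _ _)]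
      exact max_le (by linarith) hy
    have h2 : |max (y - d) 0 - y| ≤ d := by
      rw [abs_le]
      constructor
      · linarith [le_max_left (y - d) 0]
      · linarith [max_le (by linarith : y - d ≤ y) hy]
    have h3 := abs_pow_sub_pow_le (max (y - d) 0) y (k + 1)
    rw [abs_of_nonneg hy, max_eq_right h1, Nat.add_sub_cancel] at h3
    rw [norm_mul, Real.norm_eq_abs, Real.norm_eq_abs, abs_of_pos (inv_pos.2 hd),
      inv_mul_le_iff₀ hd]
    refine h3.trans ?_
    push_cast
    rw [mul_assoc]
    gcongr
  · filter_upwards [h0] with y hy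
    have h1 : HasDerivAt (fun d : ℝ => (y - d) ^ (k + 1)) (-(((k : ℝ) + 1) * y ^ k)) 0 := by
      have := ((hasDerivAt_id (0 : ℝ)).const_sub y).fun_pow (k + 1)
      simpa using this
    refine h1.tendsto_slope_zero_right.congr' ?_
    filter_upwards [nhdsWithin_le_nhds (gt_mem_nhds hy)] with d hd
    rw [max_eq_left (sub_nonneg.2 (le_of_lt hd))]
    simp

theorem lintegral_tail_combination {ι : Type*} [Countable ι] (μ : Measure ℝ) (ν : ι → Measure ℝ)
    (A : ℝ≥0∞) (a : ι → ℝ≥0∞) (k : ℕ) :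
    ∫⁻ x in Set.Ioi (0 : ℝ), (μ (Set.Ici x) * A + ∑' e, ν e (Set.Ici x) * a e) *
        ENNReal.ofReal ((k + 1) * x ^ k) =
      (∫⁻ y, ENNReal.ofReal (max (y - 0) 0 ^ (k + 1)) ∂μ) * A +
        ∑' e, (∫⁻ y, ENNReal.ofReal (max (y - 0) 0 ^ (k + 1)) ∂ν e) * a e := by
  have hm (μ : Measure ℝ) := measurable_measure_Ici μ
  have key (w : ℝ → ℝ≥0∞) (hw : Measurable w) :
      ∫⁻ x in Set.Ioi (0 : ℝ), (μ (Set.Ici x) * A + ∑' e, ν e (Set.Ici x) * a e) * w x =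
        (∫⁻ x in Set.Ioi 0, μ (Set.Ici x) * w x) * A +
          ∑' e, (∫⁻ x in Set.Ioi 0, ν e (Set.Ici x) * w x) * a e := by
    simp only [add_mul, ← ENNReal.tsum_mul_right]
    have h1 (μ : Measure ℝ) : Measurable fun x => μ (Set.Ici x) * w x := (hm μ).mul hw
    have h2 (μ : Measure ℝ) (A : ℝ≥0∞) : Measurable fun x => μ (Set.Ici x) * A * w x :=
      ((hm μ).mul_const A).mul hw
    rw [lintegral_add_left (h2 _ _), lintegral_tsum fun e => (h2 _ _).aemeasurable,
      ← lintegral_mul_const _ (h1 _)]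
    congr 1
    · exact lintegral_congr fun x => mul_right_comm _ _ _
    · refine tsum_congr fun e => ?_
      rw [← lintegral_mul_const _ (h1 _)]
      exact lintegral_congr fun x => mul_right_comm _ _ _
  simp only [lintegral_posPart_sub_pow, add_zero]
  exact key _ (by fun_prop)

theorem lintegral_posPart_sub_pow_eq_ofReal {μ : Measure ℝ} (h0 : ∀ᵐ y ∂μ, 0 ≤ y) {k : ℕ}
    (hk : Integrable (fun y => y ^ k) μ) {d : ℝ} (hd : 0 ≤ d) :
    ∫⁻ y, ENNReal.ofReal (max (y - d) 0 ^ k) ∂μ =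
      ENNReal.ofReal (∫ y, max (y - d) 0 ^ k ∂μ) :=
  (ofReal_integral_eq_lintegral_ofReal (integrable_posPart_sub_pow h0 hk hd)
    (.of_forall fun y => by positivity)).symm

/-- Integrates the right sides of the two tail bounds into the real combination of moments used for
the difference quotients. -/
theorem lintegral_tail_combination_eq_ofReal {ι : Type*} [Countable ι] {μ : Measure ℝ}
    {ν : ι → Measure ℝ} {k : ℕ} (hμ0 : ∀ᵐ y ∂μ, 0 ≤ y) (hν0 : ∀ e, ∀ᵐ y ∂ν e, 0 ≤ y)
    (hμ : Integrable (fun y => y ^ (k + 1)) μ) (hν : ∀ e, Integrable (fun y => y ^ (k + 1)) (ν e))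
    {A : ℝ} (hA : 0 ≤ A) {a : ι → ℝ} (ha : ∀ e, 0 ≤ a e)
    (hs : Summable fun e => a e * ∫ y, y ^ (k + 1) ∂ν e) :
    ∫⁻ x in Set.Ioi (0 : ℝ), (μ (Set.Ici x) * ENNReal.ofReal A +
        ∑' e, ν e (Set.Ici x) * ENNReal.ofReal (a e)) * ENNReal.ofReal ((k + 1) * x ^ k) =
      ENNReal.ofReal (A * ∫ y, y ^ (k + 1) ∂μ + ∑' e, a e * ∫ y, y ^ (k + 1) ∂ν e) := by
  have key (μ : Measure ℝ) (h0 : ∀ᵐ y ∂μ, 0 ≤ y) (hk : Integrable (fun y => y ^ (k + 1)) μ) :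
      ∫⁻ y, ENNReal.ofReal (max (y - 0) 0 ^ (k + 1)) ∂μ = ENNReal.ofReal (∫ y, y ^ (k + 1) ∂μ) := by
    rw [lintegral_posPart_sub_pow_eq_ofReal h0 hk le_rfl]
    congr 1
    refine integral_congr_ae ?_
    filter_upwards [h0] with y hy
    simp [hy]
  have hnn (μ : Measure ℝ) (h0 : ∀ᵐ y ∂μ, 0 ≤ y) : 0 ≤ ∫ y, y ^ (k + 1) ∂μ :=
    integral_nonneg_of_ae (h0.mono fun y hy => pow_nonneg hy _)
  have hnn' (e) : 0 ≤ a e * ∫ y, y ^ (k + 1) ∂ν e := mul_nonneg (ha e) (hnn _ (hν0 e))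
  rw [lintegral_tail_combination, key μ hμ0 hμ,
    ENNReal.ofReal_add (mul_nonneg hA (hnn μ hμ0)) (tsum_nonneg hnn'),
    ENNReal.ofReal_tsum_of_nonneg hnn' hs, mul_comm A, ENNReal.ofReal_mul (hnn μ hμ0)]
  congr 1
  refine tsum_congr fun e => ?_
  rw [key _ (hν0 e) (hν e), mul_comm (a e), ENNReal.ofReal_mul (hnn _ (hν0 e))]

theorem one_sub_exp_neg_nonneg {a d : ℝ} (ha : 0 ≤ a) (hd : 0 ≤ d) :
    0 ≤ 1 - Real.exp (-(a * d)) := by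
  simp only [sub_nonneg, Real.exp_le_one_iff, Left.neg_nonpos_iff]
  positivity

theorem one_sub_exp_neg_le (a : ℝ) : 1 - Real.exp (-a) ≤ a := by
  linarith [Real.add_one_le_exp (-a)]

theorem tendsto_slope_one_sub_exp (a : ℝ) :
    Tendsto (fun d : ℝ => d⁻¹ * (1 - Real.exp (-(a * d)))) (𝓝[>] 0) (𝓝 a) := by
  have h : HasDerivAt (fun d : ℝ => 1 - Real.exp (-(a * d))) a 0 := by
    have := ((((hasDerivAt_id (0 : ℝ)).const_mul a).neg).exp).const_sub 1
    simpa using this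
  simpa using h.tendsto_slope_zero_right

/-- The limit of two bounds for a difference quotient. -/
theorem eq_of_tendsto_slope_of_bounds {ι : Type*} {D m b M : ℝ} {φ : ℝ → ℝ} {r c ν : ι → ℝ}
    (hD : 0 ≤ D) (hr : ∀ e, 0 ≤ r e) (hrs : Summable r) (hc : ∀ e, 0 ≤ c e) (hν : ∀ e, 0 ≤ ν e)
    (hνM : ∀ e, ν e ≤ M)
    (hφ : Tendsto (fun d => d⁻¹ * (φ d - m)) (𝓝[>] 0) (𝓝 b))
    (hlower : ∀ d, 0 < d → Real.exp (-(D * d)) * m +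
      ∑' e, (1 - Real.exp (-(r e * d))) * Real.exp (-((D + c e) * d)) * ν e ≤ φ d)
    (hupper : ∀ d, 0 < d → φ d ≤ Real.exp (-(D * d)) * m +
      ∑' e, (1 - Real.exp (-(r e * d))) * ν e) :
    b = -(D * m) + ∑' e, r e * ν e := by
  -- From `1 - exp (-a) ≤ a`; the bound is summable in `e` and independent of `d`, as dominated
  -- convergence requires.
  have hbound (d : ℝ) (hd : 0 < d) (e : ι) :
      d⁻¹ * (1 - Real.exp (-(r e * d))) * ν e ≤ r e * M := by
    have h1 : d⁻¹ * (1 - Real.exp (-(r e * d))) ≤ r e := by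
      rw [inv_mul_le_iff₀ hd, mul_comm d]
      exact one_sub_exp_neg_le _
    exact mul_le_mul h1 (hνM e) (hν e) (hr e)
  have hnn (d : ℝ) (hd : 0 < d) (e : ι) : 0 ≤ d⁻¹ * (1 - Real.exp (-(r e * d))) * ν e :=
    mul_nonneg (mul_nonneg (inv_nonneg.2 hd.le) (one_sub_exp_neg_nonneg (hr e) hd.le)) (hν e)
  have hexp : Tendsto (fun d : ℝ => -(d⁻¹ * (1 - Real.exp (-(D * d))) * m)) (𝓝[>] 0)
      (𝓝 (-(D * m))) := ((tendsto_slope_one_sub_exp D).mul_const m).neg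
  have hU : Tendsto (fun d : ℝ => -(d⁻¹ * (1 - Real.exp (-(D * d))) * m) +
      ∑' e, d⁻¹ * (1 - Real.exp (-(r e * d))) * ν e) (𝓝[>] 0)
      (𝓝 (-(D * m) + ∑' e, r e * ν e)) := by
    refine hexp.add (tendsto_tsum_of_dominated_convergence (hrs.mul_right M)
      (fun e => (tendsto_slope_one_sub_exp (r e)).mul_const _) ?_)
    filter_upwards [self_mem_nhdsWithin] with d hd e
    rw [Real.norm_of_nonneg (hnn d hd e)]
    exact hbound d hd e
  have hL : Tendsto (fun d : ℝ => -(d⁻¹ * (1 - Real.exp (-(D * d))) * m) +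
      ∑' e, d⁻¹ * (1 - Real.exp (-(r e * d))) * ν e * Real.exp (-((D + c e) * d))) (𝓝[>] 0)
      (𝓝 (-(D * m) + ∑' e, r e * ν e)) := by
    -- The `c e` may be unbounded in `e`: each extra factor is at most `1` and tends to `1`
    -- pointwise, so no uniformity is needed.
    refine hexp.add (tendsto_tsum_of_dominated_convergence (hrs.mul_right M) (fun e => ?_) ?_)
    · have h1 : Tendsto (fun d : ℝ => Real.exp (-((D + c e) * d))) (𝓝[>] 0) (𝓝 1) := by
        have : Continuous fun d : ℝ => Real.exp (-((D + c e) * d)) := by fun_prop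
        simpa using (this.tendsto 0).mono_left nhdsWithin_le_nhds
      simpa using ((tendsto_slope_one_sub_exp (r e)).mul_const (ν e)).mul h1
    · filter_upwards [self_mem_nhdsWithin] with d hd e
      have hd : 0 < d := hd
      have h1 : Real.exp (-((D + c e) * d)) ≤ 1 := by
        have := hc e
        simp only [Real.exp_le_one_iff, Left.neg_nonpos_iff]
        positivity
      rw [Real.norm_of_nonneg (mul_nonneg (hnn d hd e) (Real.exp_pos _).le)]
      exact (mul_le_of_le_one_right (hnn d hd e) h1).trans (hbound d hd e)
  refine le_antisymm (le_of_tendsto_of_tendsto hφ hU ?_) (le_of_tendsto_of_tendsto hL hφ ?_)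
  · filter_upwards [self_mem_nhdsWithin] with d hd
    have h1 := mul_le_mul_of_nonneg_left (hupper d hd) (inv_pos.2 hd).le
    have h2 : d⁻¹ * ∑' e, (1 - Real.exp (-(r e * d))) * ν e =
        ∑' e, d⁻¹ * (1 - Real.exp (-(r e * d))) * ν e := by
      rw [← tsum_mul_left]
      exact tsum_congr fun e => by ring
    rw [mul_add, h2] at h1
    linear_combination h1
  · filter_upwards [self_mem_nhdsWithin] with d hd
    have h1 := mul_le_mul_of_nonneg_left (hlower d hd) (inv_pos.2 hd).le
    have h2 : d⁻¹ * ∑' e, (1 - Real.exp (-(r e * d))) * Real.exp (-((D + c e) * d)) * ν e =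
        ∑' e, d⁻¹ * (1 - Real.exp (-(r e * d))) * ν e * Real.exp (-((D + c e) * d)) := by
      rw [← tsum_mul_left]
      exact tsum_congr fun e => by ring
    rw [mul_add, h2] at h1
    linear_combination h1

/-! ### Moments of the age law and their recursion -/

namespace GossipNetwork

variable {V : Type*} {G : GossipNetwork V} {Ω : Type*} [mΩ : MeasurableSpace Ω] {P : Measure Ω}
  {ring : V × V → Ω → Set ℝ} {S : Set V} {L : Measure ℝ}

variable (G P ring S L) in
/-- The law `L` is the limit of the laws of the ages of `S`, which are its truncations. -/
structure IsAgeLaw : Prop where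
  isProbabilityMeasure : IsProbabilityMeasure L
  map_min : ∀ t, 0 ≤ t → L.map (min · t) = P.map (fun ω => G.age (fun e => ring e ω) S t)

variable [IsProbabilityMeasure P] [Countable V]

theorem IsAgeLaw.measure_Iic (hL : G.IsAgeLaw P ring S L) (h : G.IsClockFamily P ring)
    (hS : G.source ∉ S) (hne : S.Nonempty) {t x : ℝ} (ht : 0 ≤ t) (hx : x < t) :
    P {ω | G.age (fun e => ring e ω) S t ≤ x} = L (Set.Iic x) := by
  have h1 := congrArg (fun μ => μ (Set.Iic x)) (hL.map_min t ht)
  rw [Measure.map_apply (by fun_prop) measurableSet_Iic,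
    Measure.map_apply_of_aemeasurable (h.aemeasurable_age hS hne ht) measurableSet_Iic] at h1
  refine h1.symm.trans (congrArg L ?_)
  ext y
  simp [hx.not_ge]

/-- Read the truncation at time `x` itself: `min y x ≥ x` exactly when `y ≥ x`. -/
theorem IsAgeLaw.measure_Ici (hL : G.IsAgeLaw P ring S L) (h : G.IsClockFamily P ring)
    (hS : G.source ∉ S) (hne : S.Nonempty) {x : ℝ} (hx : 0 ≤ x) :
    L (Set.Ici x) = P (G.staleSet ring S 0 x) := by
  have h1 := congrArg (fun μ => μ (Set.Ici x)) (hL.map_min x hx)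
  rw [Measure.map_apply (by fun_prop) measurableSet_Ici,
    Measure.map_apply_of_aemeasurable (h.aemeasurable_age hS hne hx) measurableSet_Ici] at h1
  rw [← h.measure_le_age hS hne hx le_rfl]
  refine Eq.trans (congrArg L ?_) h1
  ext y
  simp

theorem IsAgeLaw.ae_nonneg (hL : G.IsAgeLaw P ring S L) (h : G.IsClockFamily P ring)
    (hS : G.source ∉ S) (hne : S.Nonempty) : ∀ᵐ y ∂L, 0 ≤ y := by
  have := hL.isProbabilityMeasure
  have h1 := hL.measure_Ici h hS hne le_rfl
  rw [staleSet_self, measure_univ] at h1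
  exact (prob_compl_eq_zero_iff measurableSet_Ici).2 h1

theorem IsAgeLaw.integrable_pow (hL : G.IsAgeLaw P ring S L) (h : G.IsClockFamily P ring)
    (hS : G.source ∉ S) (hr : G.Reaches S) (k : ℕ) : Integrable (fun y => y ^ k) L := by
  have := hL.isProbabilityMeasure
  obtain ⟨C, c, hC, hc, hle⟩ := h.measure_staleSet_le hS hr
  refine integrable_pow_of_measure_Ici_le (hL.ae_nonneg h hS hr.nonempty) hC hc (fun x hx => ?_) k
  rw [hL.measure_Ici h hS hr.nonempty hx]
  exact hle x hx

theorem IsClockFamily.integrable_age_pow (h : G.IsClockFamily P ring)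
    (hS : G.source ∉ S) (hr : G.Reaches S) (k : ℕ) {t : ℝ} (ht : 0 ≤ t) :
    Integrable (fun ω => G.age (fun e => ring e ω) S t ^ k) P := by
  refine Integrable.of_bound
    ((h.aemeasurable_age hS hr.nonempty ht).pow_const k).aestronglyMeasurable (t ^ k)
    (.of_forall fun ω => ?_)
  have h1 := age_nonneg (G := G) (fun e => ring e ω) S ht
  rw [Real.norm_of_nonneg (pow_nonneg h1 k)]
  exact pow_le_pow_left₀ h1 (age_le _ hr.nonempty ht) k

theorem IsAgeLaw.integral_age_pow (hL : G.IsAgeLaw P ring S L) (h : G.IsClockFamily P ring)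
    (hS : G.source ∉ S) (hne : S.Nonempty) (k : ℕ) {t : ℝ} (ht : 0 ≤ t) :
    ∫ ω, G.age (fun e => ring e ω) S t ^ k ∂P = ∫ y, min y t ^ k ∂L := by
  rw [← integral_map (f := fun y => y ^ k) (h.aemeasurable_age hS hne ht) (by fun_prop),
    ← hL.map_min t ht, integral_map (by fun_prop) (by fun_prop)]

theorem IsAgeLaw.tendsto_integral_age_pow (hL : G.IsAgeLaw P ring S L)
    (h : G.IsClockFamily P ring) (hS : G.source ∉ S) (hr : G.Reaches S) (k : ℕ) :
    Tendsto (fun t : ℝ => ∫ ω, G.age (fun e => ring e ω) S t ^ k ∂P) atTop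
      (𝓝 (∫ y, y ^ k ∂L)) := by
  refine (tendsto_integral_min_pow (hL.ae_nonneg h hS hr.nonempty)
    (hL.integrable_pow h hS hr k)).congr' ?_
  filter_upwards [eventually_ge_atTop 0] with t ht
  exact (hL.integral_age_pow h hS hr.nonempty k ht).symm

/-- If `S` is updated at a finite rate, its age is positive. -/
theorem IsAgeLaw.ae_pos (hL : G.IsAgeLaw P ring S L) (h : G.IsClockFamily P ring)
    (hS : G.source ∉ S) (hne : S.Nonempty) (hfin : G.FiniteInRate S) : ∀ᵐ y ∂L, 0 < y := by
  have := hL.isProbabilityMeasure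
  refine (prob_compl_eq_zero_iff measurableSet_Ioi).2 (le_antisymm prob_le_one ?_)
  have h1 : Tendsto (fun d : ℝ => ENNReal.ofReal (Real.exp (-(G.inRate S * d)))) (𝓝[>] 0)
      (𝓝 1) := by
    have : Continuous fun d : ℝ => ENNReal.ofReal (Real.exp (-(G.inRate S * d))) :=
      ENNReal.continuous_ofReal.comp (by fun_prop)
    simpa using (this.tendsto 0).mono_left nhdsWithin_le_nhds
  refine le_of_tendsto h1 ?_
  filter_upwards [self_mem_nhdsWithin] with d hd
  have hd : 0 < d := hd
  -- At time `0` everything is stale, so the silence term alone gives mass at least `exp (-D d)` to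
  -- `[d, ∞)`, where `D` is `G.inRate S`.
  have h2 := h.le_measure_staleSet_add hS hfin 0 d.toNNReal
  simp only [NNReal.coe_zero, staleSet_self, measure_univ, one_mul, zero_add,
    Real.coe_toNNReal _ hd.le] at h2
  rw [← hL.measure_Ici h hS hne hd.le] at h2
  exact (le_self_add.trans h2).trans (measure_mono fun y hy => hd.trans_le hy)

/-- A larger set is stale less often. The moments of all `S ∪ e` are thereby bounded by that of `S`,
which controls the series over `boundary`. -/
theorem IsAgeLaw.integral_pow_le {S' : Set V} {L' : Measure ℝ} (hL : G.IsAgeLaw P ring S L)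
    (hL' : G.IsAgeLaw P ring S' L') (h : G.IsClockFamily P ring) (hS : G.source ∉ S)
    (hS' : G.source ∉ S') (hr : G.Reaches S) (hSS' : S ⊆ S') (k : ℕ) :
    ∫ y, y ^ (k + 1) ∂L' ≤ ∫ y, y ^ (k + 1) ∂L := by
  have hr' := hr.mono hSS'
  have h0 := hL.ae_nonneg h hS hr.nonempty
  have h0' := hL'.ae_nonneg h hS' hr'.nonempty
  have e (μ : Measure ℝ) (h0 : ∀ᵐ y ∂μ, 0 ≤ y) :
      ∫ y, y ^ (k + 1) ∂μ = ∫ y, max (y - 0) 0 ^ (k + 1) ∂μ := by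
    refine integral_congr_ae ?_
    filter_upwards [h0] with y hy
    simp [hy]
  rw [e L h0, e L' h0', ← ENNReal.ofReal_le_ofReal_iff (integral_nonneg fun y => by positivity),
    ← lintegral_posPart_sub_pow_eq_ofReal h0 (hL.integrable_pow h hS hr _) le_rfl,
    ← lintegral_posPart_sub_pow_eq_ofReal h0' (hL'.integrable_pow h hS' hr' _) le_rfl,
    lintegral_posPart_sub_pow, lintegral_posPart_sub_pow]
  refine setLIntegral_mono' measurableSet_Ioi fun x hx => ?_
  have hx : (0 : ℝ) < x := hx
  rw [add_zero, hL.measure_Ici h hS hr.nonempty hx.le, hL'.measure_Ici h hS' hr'.nonempty hx.le]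
  gcongr
  exact staleSet_anti hSS' le_rfl

/-- The recursion for the moments of the age. -/
theorem IsAgeLaw.inRate_mul_integral_pow {law : Set V → Measure ℝ}
    (hlaw : ∀ S, G.source ∉ S → G.Reaches S → G.IsAgeLaw P ring S (law S))
    (h : G.IsClockFamily P ring) (hS : G.source ∉ S) (hr : G.Reaches S) (hfin : G.FiniteInRate S)
    (k : ℕ) :
    G.inRate S * ∫ y, y ^ (k + 1) ∂law S = (k + 1) * ∫ y, y ^ k ∂law S +
      ∑' e : G.boundary S,
        G.rate e.1.1 e.1.2 * ∫ y, y ^ (k + 1) ∂law (S ∪ {e.1.1, e.1.2}) := by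
  have hL := hlaw S hS hr
  have hS' (e : G.boundary S) := source_notMem_union hS e.2
  have hr' (e : G.boundary S) : G.Reaches (S ∪ {e.1.1, e.1.2}) := hr.mono Set.subset_union_left
  have hL' (e : G.boundary S) := hlaw _ (hS' e) (hr' e)
  have hpos := hL.ae_pos h hS hr.nonempty hfin
  have hD : 0 ≤ G.inRate S := (inRate_pos hS hr hfin).le
  have h0 := hL.ae_nonneg h hS hr.nonempty
  have h0' (e : G.boundary S) := (hL' e).ae_nonneg h (hS' e) (hr' e).nonempty
  have hint (k : ℕ) := hL.integrable_pow h hS hr k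
  have hint' (e : G.boundary S) := (hL' e).integrable_pow h (hS' e) (hr' e) (k + 1)
  have hν0 (e : G.boundary S) : 0 ≤ ∫ y, y ^ (k + 1) ∂law (S ∪ {e.1.1, e.1.2}) :=
    integral_nonneg_of_ae ((h0' e).mono fun y hy => pow_nonneg hy _)
  have hνM (e : G.boundary S) := hL.integral_pow_le (hL' e) h hS (hS' e) hr Set.subset_union_left k
  have hc (e : G.boundary S) : 0 ≤ G.totalRate e.1.1 := tsum_nonneg fun _ => rateOn_nonneg _ _
  have hM : 0 ≤ ∫ y, y ^ (k + 1) ∂law S :=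
    integral_nonneg_of_ae (h0.mono fun y hy => pow_nonneg hy _)
  have ha (d : ℝ) (hd : 0 < d) (e : G.boundary S) :
      0 ≤ 1 - Real.exp (-(G.rate e.1.1 e.1.2 * d)) := one_sub_exp_neg_nonneg (NNReal.coe_nonneg _) hd.le
  have hsum (d : ℝ) (hd : 0 < d) : Summable fun e : G.boundary S =>
      (1 - Real.exp (-(G.rate e.1.1 e.1.2 * d))) *
        ∫ y, y ^ (k + 1) ∂law (S ∪ {e.1.1, e.1.2}) := by
    refine ((hfin.2.mul_right d).mul_right (∫ y, y ^ (k + 1) ∂law S)).of_nonneg_of_le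
      (fun e => mul_nonneg (ha d hd e) (hν0 e)) fun e => ?_
    exact mul_le_mul (one_sub_exp_neg_le _) (hνM e) (hν0 e) (by positivity)
  have hexp (d : ℝ) (hd : 0 < d) (e : G.boundary S) :
      Real.exp (-((G.inRate S + G.totalRate e.1.1) * d)) ≤ 1 := by
    have := hc e
    simp only [Real.exp_le_one_iff, Left.neg_nonpos_iff]
    positivity
  -- The remaining goals are the two integrated tail bounds. Each is rewritten, through
  -- `ENNReal.ofReal`, as an inequality of integrals over `x > 0` and then holds pointwise in `x`.
  have key := eq_of_tendsto_slope_of_bounds (φ := fun d => ∫ y, max (y - d) 0 ^ (k + 1) ∂law S)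
    (m := ∫ y, y ^ (k + 1) ∂law S) hD
    (fun e : G.boundary S => NNReal.coe_nonneg (G.rate e.1.1 e.1.2)) hfin.2 hc hν0 hνM
    (tendsto_slope_integral_posPart_sub_pow hpos (hint k) (hint (k + 1))) ?_ ?_
  · linear_combination key
  · intro d hd
    rw [← ENNReal.ofReal_le_ofReal_iff (integral_nonneg fun y => by positivity),
      ← lintegral_posPart_sub_pow_eq_ofReal h0 (hint _) hd.le,
      ← lintegral_tail_combination_eq_ofReal h0 h0' (hint _) hint' (Real.exp_pos _).le
        (fun e => mul_nonneg (ha d hd e) (Real.exp_pos _).le), lintegral_posPart_sub_pow]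
    · refine setLIntegral_mono' measurableSet_Ioi fun x hx => ?_
      have hx : (0 : ℝ) < x := hx
      gcongr
      rw [hL.measure_Ici h hS hr.nonempty hx.le,
        hL.measure_Ici h hS hr.nonempty (add_pos hx hd).le]
      have h1 := h.le_measure_staleSet_add hS hfin x.toNNReal d.toNNReal
      simp only [Real.coe_toNNReal _ hx.le, Real.coe_toNNReal _ hd.le] at h1
      refine le_trans (le_of_eq ?_) h1
      congr 1
      exact tsum_congr fun e => by rw [(hL' e).measure_Ici h (hS' e) (hr' e).nonempty hx.le]
    · refine (hsum d hd).of_nonneg_of_le (fun e => mul_nonneg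
        (mul_nonneg (ha d hd e) (Real.exp_pos _).le) (hν0 e)) fun e => ?_
      exact mul_le_mul_of_nonneg_right (mul_le_of_le_one_right (ha d hd e) (hexp d hd e)) (hν0 e)
  · intro d hd
    rw [← ENNReal.ofReal_le_ofReal_iff (add_nonneg (mul_nonneg (Real.exp_pos _).le hM)
        (tsum_nonneg fun e => mul_nonneg (ha d hd e) (hν0 e))),
      ← lintegral_posPart_sub_pow_eq_ofReal h0 (hint _) hd.le,
      ← lintegral_tail_combination_eq_ofReal h0 h0' (hint _) hint' (Real.exp_pos _).le
        (ha d hd) (hsum d hd), lintegral_posPart_sub_pow]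
    refine setLIntegral_mono' measurableSet_Ioi fun x hx => ?_
    have hx : (0 : ℝ) < x := hx
    gcongr
    rw [hL.measure_Ici h hS hr.nonempty hx.le,
      hL.measure_Ici h hS hr.nonempty (add_pos hx hd).le]
    have h1 := h.measure_staleSet_add_le hS hfin x.toNNReal d.toNNReal
    simp only [Real.coe_toNNReal _ hx.le, Real.coe_toNNReal _ hd.le] at h1
    refine h1.trans (le_of_eq ?_)
    congr 1
    exact tsum_congr fun e => by rw [(hL' e).measure_Ici h (hS' e) (hr' e).nonempty hx.le]

end GossipNetwork

/-! ### The theorem -/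

theorem theorem2 {V : Type*} [Countable V] (G : GossipNetwork V)
    {Ω : Type*} [MeasurableSpace Ω] (P : Measure Ω) [IsProbabilityMeasure P]
    (ring : V × V → Ω → Set ℝ) (hring : G.IsClockFamily P ring) :
    ∃ law : Set V → Measure ℝ,
      -- `law S` is the time-invariant law of the age of `S`, with its moments
      (∀ S : Set V, G.source ∉ S → G.Reaches S →
        IsProbabilityMeasure (law S) ∧
        (∀ t : ℝ, 0 ≤ t → ∀ x < t,
          P {ω | G.age (fun e => ring e ω) S t ≤ x} = law S (Set.Iic x)) ∧
        ∀ k : ℕ, Integrable (fun x => x ^ k) (law S) ∧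
          (∀ t : ℝ, 0 ≤ t → Integrable (fun ω => G.age (fun e => ring e ω) S t ^ k) P) ∧
          Tendsto (fun t : ℝ => ∫ ω, G.age (fun e => ring e ω) S t ^ k ∂P) atTop
            (𝓝 (∫ x, x ^ k ∂law S))) ∧
      -- the recursion for the moments
      ∀ S : Set V, G.source ∉ S → G.Reaches S → G.FiniteInRate S → 0 < G.inRate S ∧
        ∀ k : ℕ, 1 ≤ k →
          ∫ x, x ^ k ∂law S =
            (k * ∫ x, x ^ (k - 1) ∂law S +
              ∑' e : G.boundary S,
                G.rate e.1.1 e.1.2 * ∫ x, x ^ k ∂law (S ∪ {e.1.1, e.1.2})) / G.inRate S := by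
  have hex (S : Set V) : ∃ L : Measure ℝ, G.source ∉ S → G.Reaches S → G.IsAgeLaw P ring S L := by
    by_cases hS : G.source ∉ S ∧ G.Reaches S
    · obtain ⟨L, h1, h2⟩ := hring.exists_law hS.1 hS.2
      exact ⟨L, fun _ _ => ⟨h1, h2⟩⟩
    · exact ⟨0, fun h1 h2 => absurd ⟨h1, h2⟩ hS⟩
  choose law hlaw using hex
  refine ⟨law, fun S hS hr => ?_, fun S hS hr hfin => ⟨G.inRate_pos hS hr hfin, ?_⟩⟩
  · have hL := hlaw S hS hr
    exact ⟨hL.isProbabilityMeasure, fun t ht x hx => hL.measure_Iic hring hS hr.nonempty ht hx,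
      fun k => ⟨hL.integrable_pow hring hS hr k,
        fun t ht => hring.integrable_age_pow hS hr k ht,
        hL.tendsto_integral_age_pow hring hS hr k⟩⟩
  · rintro (_ | k) hk
    · omega
    · rw [eq_div_iff (G.inRate_pos hS hr hfin).ne', mul_comm,
        GossipNetwork.IsAgeLaw.inRate_mul_integral_pow hlaw hring hS hr hfin k]
      simp
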